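/- Let $L^2(\mathbb{R})$ be the complex Hilbert space of square-integrable functions for Lebesgue measure, let $\mathbb{T}=\{w\in\mathbb{C}:|w|=1\}$, and write $\sigma(T)$ for the spectrum and $\|T\|$ for the operator norm of a bounded operator $T$ on $L^2(\mathbb{R})$. Let $\mathcal{C}$ be the Cesàro operator on $L^2(\mathbb{R})$, $$(\mathcal{C}f)(x)=\frac1x\int_0^x f(t)\,dt=\int_0^1 f(ux)\,du ,$$ which is a bounded normal operator with spectrum $\mathbb{T}+1$. For $\alpha\in\mathbb{C}$ with $\operatorname{Re}\alpha>0$ let $H_\alpha$ be the Hölder mean of order $\alpha$, the bounded operator on $L^2(\mathbb{R})$ given by $$(H_\alpha f)(x)=\frac{1}{\Gamma(\alpha)}\int_0^1\left(\log\frac1u\right)^{\alpha-1}f(ux)\,du ,$$ and let $\mathcal{C}^\alpha$ be the operator obtained from $\mathcal{C}$ by the functional calculus of normal operators applied to the function $z\mapsto z^\alpha$, continuous on $\mathbb{T}+1$, where $z^\alpha$ is the principal branch for $\operatorname{Re} z>0$ (so $1^\alpha=1$) and $0^\alpha:=0$. Let $\operatorname{Re}\alpha>0$. Then $$\sigma(H_\alpha)=\sigma(\mathcal{C}^\alpha)=\{z^\alpha: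 z\in\mathbb{T}+1\}$$ and $$\|H_\alpha\|=\|\mathcal{C}^\alpha\|=\left(\frac{2\operatorname{Re}\alpha}{|\alpha|}\right)^{\operatorname{Re}\alpha}e^{\operatorname{Im}(\alpha)\arg(\alpha)},$$ where $\arg\alpha\in(-\pi/2,\pi/2)$ is the principal argument. In particular, if $\alpha>0$ is real, then $\sigma(H_\alpha)=\sigma(\mathcal{C}^\alpha)$ is the curve $$\left\{\big((2\cos t)^\alpha\cos\alpha t,\ (2\cos t)^\alpha\sin\alpha t\big): t\in\left[-\frac\pi2,\frac\pi2\right]\right\}\subset\mathbb{R}^2=\mathbb{C}$$ and $\|H_\alpha\|=\|\mathcal{C}^\alpha\|=2^\alpha$. -/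

import Mathlib

open MeasureTheory Set
open scoped ENNReal

noncomputable section

/-- The complex Hilbert space `L²(ℝ)` for Lebesgue measure. -/
abbrev L2R : Type := Lp ℂ 2 (volume : Measure ℝ)

/-- The integral `∫_ℝ K(u) f(u x) du`. -/
def hausdorffFun (K f : ℝ → ℂ) (x : ℝ) : ℂ := ∫ u : ℝ, K u * f (u * x)

/-- The condition `K(u) |u|^{-1/2} ∈ L¹(ℝ)`. -/
def HausdorffKernel (K : ℝ → ℂ) : Prop :=
  Integrable (fun u : ℝ => K u * ((|u| ^ (-(1 / 2) : ℝ) : ℝ) : ℂ)) volume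

namespace HausdorffKernel

/-- The constant `∫ |K(u)| |u|^{-1/2} du`, with values in `[0, ∞]`. -/
def bound (K : ℝ → ℂ) : ℝ≥0∞ :=
  ∫⁻ u : ℝ, ‖K u‖ₑ * (ENNReal.ofReal (|u| ^ (1 / 2 : ℝ)))⁻¹

theorem ae_ne_zero : ∀ᵐ u : ℝ, u ≠ 0 := by
  simp [ae_iff]

theorem aestronglyMeasurable {K : ℝ → ℂ} (hK : HausdorffKernel K) :
    AEStronglyMeasurable K volume := by
  have h1 : AEStronglyMeasurable (fun u : ℝ => ((|u| ^ (1 / 2 : ℝ) : ℝ) : ℂ)) volume := by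
    apply Measurable.aestronglyMeasurable
    fun_prop
  refine (hK.1.mul h1).congr ?_
  filter_upwards [ae_ne_zero] with u hu
  have hpos : 0 < |u| := abs_pos.mpr hu
  simp only [Pi.mul_apply]
  rw [mul_assoc, ← Complex.ofReal_mul, ← Real.rpow_add hpos]
  norm_num

theorem bound_ne_top {K : ℝ → ℂ} (hK : HausdorffKernel K) : bound K ≠ ∞ := by
  have h := hK.2
  rw [hasFiniteIntegral_iff_enorm] at h
  refine ne_of_lt (lt_of_le_of_lt (le_of_eq ?_) h)
  apply lintegral_congr_ae
  filter_upwards [ae_ne_zero] with u hu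
  have hpos : 0 < |u| := abs_pos.mpr hu
  rw [enorm_mul, ← ENNReal.ofReal_inv_of_pos (Real.rpow_pos_of_pos hpos _),
    ← Real.rpow_neg hpos.le, ← ofReal_norm (_ : ℂ), ← ofReal_norm (((_ : ℝ) : ℂ)),
    Complex.norm_real, Real.norm_of_nonneg (Real.rpow_nonneg hpos.le _)]

theorem lintegral_comp_mul {g : ℝ → ℝ≥0∞} (hg : Measurable g) {u : ℝ} (hu : u ≠ 0) :
    ∫⁻ x : ℝ, g (u * x) = ENNReal.ofReal |u|⁻¹ * ∫⁻ x, g x := by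
  have h := Real.map_volume_mul_left hu
  rw [← lintegral_map hg (by fun_prop : Measurable fun x : ℝ => u * x), h,
    lintegral_smul_measure, abs_inv, smul_eq_mul]

/-- Cauchy-Schwarz and Tonelli. -/
theorem lintegral_sq_le {K : ℝ → ℂ} (hK : HausdorffKernel K) {g : ℝ → ℝ≥0∞}
    (hg : Measurable g) :
    ∫⁻ x : ℝ, (∫⁻ u : ℝ, ‖K u‖ₑ * g (u * x)) ^ 2 ≤ bound K ^ 2 * ∫⁻ x, g x ^ 2 := by
  have hk : AEMeasurable (fun u => ‖K u‖ₑ) volume := hK.aestronglyMeasurable.enorm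
  set w : ℝ → ℝ≥0∞ := fun u => ENNReal.ofReal (|u| ^ (1 / 2 : ℝ)) with hw
  have hwm : Measurable w := by fun_prop
  have key : ∀ x : ℝ, (∫⁻ u : ℝ, ‖K u‖ₑ * g (u * x)) ^ 2 ≤
      bound K * ∫⁻ u : ℝ, ‖K u‖ₑ * w u * g (u * x) ^ 2 := by
    intro x
    have hgx : Measurable fun u : ℝ => g (u * x) := hg.comp (by fun_prop)
    have hF : AEMeasurable (fun u => (‖K u‖ₑ * (w u)⁻¹) ^ (1 / 2 : ℝ)) volume :=
      (hk.mul hwm.inv.aemeasurable).pow_const _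
    have hG : AEMeasurable (fun u => (‖K u‖ₑ * w u) ^ (1 / 2 : ℝ) * g (u * x)) volume :=
      ((hk.mul hwm.aemeasurable).pow_const _).mul hgx.aemeasurable
    have hCS := ENNReal.lintegral_mul_le_Lp_mul_Lq volume Real.HolderConjugate.two_two hF hG
    have hFG : ∫⁻ u : ℝ, ‖K u‖ₑ * g (u * x) = ∫⁻ u : ℝ,
        ((fun u => (‖K u‖ₑ * (w u)⁻¹) ^ (1 / 2 : ℝ)) *
          (fun u => (‖K u‖ₑ * w u) ^ (1 / 2 : ℝ) * g (u * x))) u := by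
      apply lintegral_congr_ae
      filter_upwards [ae_ne_zero] with u hu
      have hw0 : w u ≠ 0 := by
        simp only [hw, ne_eq, ENNReal.ofReal_eq_zero, not_le]
        exact Real.rpow_pos_of_pos (abs_pos.mpr hu) _
      have hwt : w u ≠ ∞ := ENNReal.ofReal_ne_top
      simp only [Pi.mul_apply]
      rw [← mul_assoc, ← ENNReal.mul_rpow_of_nonneg _ _ (by norm_num : (0 : ℝ) ≤ 1 / 2),
        mul_mul_mul_comm, ENNReal.inv_mul_cancel hw0 hwt, mul_one, ← sq, ← ENNReal.rpow_natCast,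
        ← ENNReal.rpow_mul]
      norm_num
    rw [hFG]
    have e1 : ∀ a : ℝ≥0∞, (a ^ (1 / 2 : ℝ)) ^ (2 : ℝ) = a := fun a => by
      rw [← ENNReal.rpow_mul]; norm_num
    have e2 : ∀ a : ℝ≥0∞, (a ^ (1 / 2 : ℝ)) ^ (2 : ℕ) = a := fun a => by
      rw [← ENNReal.rpow_natCast, ← ENNReal.rpow_mul]; norm_num
    refine (pow_le_pow_left' hCS 2).trans (le_of_eq ?_)
    rw [mul_pow, e2, e2]
    congr 1
    · simp only [e1, bound, hw]
    · apply lintegral_congr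
      intro u
      rw [ENNReal.mul_rpow_of_nonneg _ _ (by norm_num : (0 : ℝ) ≤ 2), e1, ENNReal.rpow_two]
  calc ∫⁻ x : ℝ, (∫⁻ u : ℝ, ‖K u‖ₑ * g (u * x)) ^ 2
      ≤ ∫⁻ x : ℝ, bound K * ∫⁻ u : ℝ, ‖K u‖ₑ * w u * g (u * x) ^ 2 := lintegral_mono key
    _ = bound K * ∫⁻ x : ℝ, ∫⁻ u : ℝ, ‖K u‖ₑ * w u * g (u * x) ^ 2 :=
        lintegral_const_mul' _ _ hK.bound_ne_top
    _ = bound K * ∫⁻ u : ℝ, ∫⁻ x : ℝ, ‖K u‖ₑ * w u * g (u * x) ^ 2 := by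
        congr 1
        apply lintegral_lintegral_swap
        have h1 : AEMeasurable (fun p : ℝ × ℝ => ‖K p.2‖ₑ * w p.2) (volume.prod volume) :=
          (hk.mul hwm.aemeasurable).comp_snd
        have h2 : Measurable (fun p : ℝ × ℝ => g (p.2 * p.1) ^ 2) :=
          (hg.comp (by fun_prop : Measurable fun p : ℝ × ℝ => p.2 * p.1)).pow_const 2
        exact h1.mul h2.aemeasurable
    _ = bound K * ∫⁻ u : ℝ, ‖K u‖ₑ * (w u)⁻¹ * ∫⁻ x : ℝ, g x ^ 2 := by
        congr 1
        apply lintegral_congr_ae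
        filter_upwards [ae_ne_zero] with u hu
        have hpos : 0 < |u| := abs_pos.mpr hu
        rw [lintegral_const_mul _ ((show Measurable fun x : ℝ => g (u * x) from
            hg.comp (by fun_prop)).pow_const 2),
          lintegral_comp_mul (hg.pow_const 2) hu, ← mul_assoc, mul_assoc ‖K u‖ₑ]
        congr 2
        simp only [hw]
        rw [← ENNReal.ofReal_inv_of_pos (Real.rpow_pos_of_pos hpos _),
          ← ENNReal.ofReal_mul (Real.rpow_nonneg hpos.le _), ← Real.rpow_neg hpos.le,
          ← Real.rpow_neg_one |u|, ← Real.rpow_add hpos]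
        norm_num
    _ = bound K ^ 2 * ∫⁻ x, g x ^ 2 := by
        rw [lintegral_mul_const'' _ (show AEMeasurable (fun u => ‖K u‖ₑ * (w u)⁻¹) volume from
          hk.mul hwm.inv.aemeasurable), sq, mul_assoc]
        rfl

theorem lintegral_enorm_sq (f : L2R) : ∫⁻ x, ‖f x‖ₑ ^ 2 = ‖f‖ₑ ^ 2 := by
  rw [Lp.enorm_def, eLpNorm_eq_lintegral_rpow_enorm_toReal (by norm_num) (by norm_num)]
  rw [← ENNReal.rpow_natCast, ← ENNReal.rpow_mul]
  norm_num

theorem integrable_ae {K : ℝ → ℂ} (hK : HausdorffKernel K) (f : L2R) :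
    ∀ᵐ x : ℝ, Integrable (fun u : ℝ => K u * f (u * x)) volume := by
  have hf : StronglyMeasurable f := Lp.stronglyMeasurable f
  have hb := hK.lintegral_sq_le hf.enorm
  rw [lintegral_enorm_sq] at hb
  have hlt : ∫⁻ x : ℝ, (∫⁻ u : ℝ, ‖K u‖ₑ * ‖f (u * x)‖ₑ) ^ 2 ≠ ∞ :=
    ne_of_lt (hb.trans_lt (ENNReal.mul_lt_top (ENNReal.pow_lt_top hK.bound_ne_top.lt_top)
      (ENNReal.pow_lt_top enorm_lt_top)))
  have hm : AEMeasurable (fun x : ℝ => (∫⁻ u : ℝ, ‖K u‖ₑ * ‖f (u * x)‖ₑ) ^ 2) volume := by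
    apply AEMeasurable.pow_const
    apply AEMeasurable.lintegral_prod_right' (f := fun p : ℝ × ℝ => ‖K p.2‖ₑ * ‖f (p.2 * p.1)‖ₑ)
    have h1 : AEMeasurable (fun p : ℝ × ℝ => ‖K p.2‖ₑ) (volume.prod volume) :=
      (hK.aestronglyMeasurable.enorm).comp_snd
    have h2 : Measurable (fun p : ℝ × ℝ => ‖f (p.2 * p.1)‖ₑ) :=
      hf.enorm.comp (by fun_prop : Measurable fun p : ℝ × ℝ => p.2 * p.1)
    exact h1.mul h2.aemeasurable
  filter_upwards [ae_lt_top' hm hlt] with x hx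
  refine ⟨hK.aestronglyMeasurable.mul (hf.comp_measurable
    (by fun_prop : Measurable fun u : ℝ => u * x)).aestronglyMeasurable, ?_⟩
  rw [hasFiniteIntegral_iff_enorm]
  simp only [enorm_mul]
  by_contra h
  rw [not_lt, top_le_iff] at h
  rw [h] at hx
  simp at hx

theorem eLpNorm_le {K : ℝ → ℂ} (hK : HausdorffKernel K) (f : L2R) :
    eLpNorm (hausdorffFun K f) 2 volume ≤ bound K * ‖f‖ₑ := by
  have hf : StronglyMeasurable f := Lp.stronglyMeasurable f
  have hb := hK.lintegral_sq_le hf.enorm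
  rw [lintegral_enorm_sq, ← mul_pow] at hb
  have h1 : ∫⁻ x : ℝ, ‖hausdorffFun K f x‖ₑ ^ 2 ≤ (bound K * ‖f‖ₑ) ^ 2 := by
    refine (lintegral_mono fun x => ?_).trans hb
    refine pow_le_pow_left' ?_ 2
    refine (enorm_integral_le_lintegral_enorm _).trans (le_of_eq ?_)
    simp only [enorm_mul]
  rw [eLpNorm_eq_lintegral_rpow_enorm_toReal (by norm_num) (by norm_num)]
  simp only [ENNReal.toReal_ofNat, ENNReal.rpow_ofNat]
  refine (ENNReal.rpow_le_rpow h1 (by norm_num)).trans (le_of_eq ?_)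
  rw [← ENNReal.rpow_natCast, ← ENNReal.rpow_mul]
  norm_num

theorem memLp {K : ℝ → ℂ} (hK : HausdorffKernel K) (f : L2R) :
    MemLp (hausdorffFun K f) 2 volume := by
  have hf : StronglyMeasurable f := Lp.stronglyMeasurable f
  refine ⟨?_, (hK.eLpNorm_le f).trans_lt
    (ENNReal.mul_lt_top hK.bound_ne_top.lt_top enorm_lt_top)⟩
  apply AEStronglyMeasurable.integral_prod_right' (f := fun p : ℝ × ℝ => K p.2 * f (p.2 * p.1))
  exact hK.aestronglyMeasurable.comp_snd.mul (hf.comp_measurable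
    (by fun_prop : Measurable fun p : ℝ × ℝ => p.2 * p.1)).aestronglyMeasurable

theorem hausdorffFun_congr {K f g : ℝ → ℂ} (h : f =ᵐ[volume] g) {x : ℝ} (hx : x ≠ 0) :
    hausdorffFun K f x = hausdorffFun K g x := by
  apply integral_congr_ae
  have hq : Measure.QuasiMeasurePreserving (fun u : ℝ => u * x) volume volume := by
    refine ⟨by fun_prop, ?_⟩
    rw [Real.map_volume_mul_right hx]
    exact Measure.smul_absolutelyContinuous
  filter_upwards [hq.ae h] with u hu
  rw [hu]

end HausdorffKernel

/-- The Hausdorff operator `(𝓗_K f)(x) = ∫_ℝ K(u) f(u x) du` as a bounded operator on `L²(ℝ)`,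
for a kernel `K` with `K(u) |u|^{-1/2} ∈ L¹(ℝ)`. -/
def hausdorffOp (K : ℝ → ℂ) (hK : HausdorffKernel K) : L2R →L[ℂ] L2R :=
  LinearMap.mkContinuous
    { toFun := fun f => (hK.memLp f).toLp (hausdorffFun K f)
      map_add' := by
        intro f g
        rw [← MemLp.toLp_add, MemLp.toLp_eq_toLp_iff]
        filter_upwards [HausdorffKernel.ae_ne_zero, hK.integrable_ae f, hK.integrable_ae g]
          with x hx h1 h2
        rw [HausdorffKernel.hausdorffFun_congr (Lp.coeFn_add f g) hx, Pi.add_apply]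
        simp only [hausdorffFun, Pi.add_apply, mul_add]
        exact integral_add h1 h2
      map_smul' := by
        intro c f
        rw [RingHom.id_apply, ← MemLp.toLp_const_smul, MemLp.toLp_eq_toLp_iff]
        filter_upwards [HausdorffKernel.ae_ne_zero] with x hx
        rw [HausdorffKernel.hausdorffFun_congr (Lp.coeFn_smul c f) hx, Pi.smul_apply]
        simp only [hausdorffFun, Pi.smul_apply, smul_eq_mul, mul_left_comm _ c]
        exact integral_const_mul c _ }
    (HausdorffKernel.bound K).toReal
    (by
      intro f
      have h := hK.eLpNorm_le f
      simp only [LinearMap.coe_mk, AddHom.coe_mk]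
      rw [Lp.norm_toLp, ← toReal_enorm f, ← ENNReal.toReal_mul]
      exact ENNReal.toReal_mono (ENNReal.mul_ne_top hK.bound_ne_top enorm_ne_top) h)

theorem hausdorffOp_coeFn (K : ℝ → ℂ) (hK : HausdorffKernel K) (f : L2R) :
    hausdorffOp K hK f =ᵐ[volume] fun x => ∫ u : ℝ, K u * f (u * x) :=
  (hK.memLp f).coeFn_toLp

/-- The kernel of the Hölder mean of order `α`:
`K(u) = Γ(α)⁻¹ (log (1/u))^{α-1}` for `0 < u < 1`, and `K(u) = 0` otherwise. -/
def holderKernel (α : ℂ) : ℝ → ℂ :=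
  (Ioo (0 : ℝ) 1).indicator fun u =>
    (Complex.Gamma α)⁻¹ * ((Real.log u⁻¹ : ℝ) : ℂ) ^ (α - 1)

theorem holderKernel_spec {α : ℂ} (hα : 0 < α.re) : HausdorffKernel (holderKernel α) := by
  have himg : (fun t : ℝ => Real.exp (-t)) '' Ioi 0 = Ioo 0 1 := by
    ext u
    constructor
    · rintro ⟨t, ht, rfl⟩
      exact ⟨Real.exp_pos _, by simpa using ht⟩
    · rintro ⟨h0, h1⟩
      exact ⟨-Real.log u, by simpa using Real.log_neg h0 h1, by simp [Real.exp_log h0]⟩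
  have hd : ∀ t ∈ Ioi (0 : ℝ), HasDerivWithinAt (fun t : ℝ => Real.exp (-t))
      (-Real.exp (-t)) (Ioi 0) t := by
    intro t _
    have h := ((hasDerivAt_id t).neg.exp).hasDerivWithinAt (s := Ioi 0)
    simpa using h
  have hinj : InjOn (fun t : ℝ => Real.exp (-t)) (Ioi 0) := by
    intro s _ t _ hst
    simpa using hst
  set G : ℝ → ℂ := fun u => (Complex.Gamma α)⁻¹ * ((Real.log u⁻¹ : ℝ) : ℂ) ^ (α - 1) *
    ((|u| ^ (-(1 / 2) : ℝ) : ℝ) : ℂ) with hG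
  have hmain : IntegrableOn G (Ioo 0 1) volume := by
    rw [← himg, integrableOn_image_iff_integrableOn_abs_deriv_smul measurableSet_Ioi hd hinj]
    have hΓ : IntegrableOn (fun t : ℝ => (Complex.Gamma α)⁻¹ *
        ((t : ℂ) ^ (α - 1) * Complex.exp (-(1 / 2 : ℂ) * t))) (Ioi 0) volume := by
      apply Integrable.const_mul
      have hr := integrableOn_rpow_mul_exp_neg_mul_rpow (p := 1) (s := α.re - 1) (b := 1 / 2)
        (by linarith) one_pos (by norm_num)
      refine Integrable.mono' hr (Measurable.aestronglyMeasurable (by fun_prop)) ?_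
      filter_upwards [ae_restrict_mem measurableSet_Ioi] with t ht
      rw [norm_mul, Complex.norm_cpow_eq_rpow_re_of_pos ht, Complex.norm_exp]
      simp
    refine hΓ.congr_fun (fun t _ => ?_) measurableSet_Ioi
    have he : Real.exp (-t) * |Real.exp (-t)| ^ (-(1 / 2) : ℝ) = Real.exp (-(1 / 2) * t) := by
      rw [abs_of_pos (Real.exp_pos _), ← Real.exp_mul, ← Real.exp_add]
      congr 1
      ring
    have he' : Complex.exp (-(1 / 2 : ℂ) * t) = ((Real.exp (-(1 / 2) * t) : ℝ) : ℂ) := by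
      push_cast
      rfl
    simp only [hG, abs_neg, Real.log_inv, Real.log_exp, neg_neg]
    rw [he', ← he, abs_of_pos (Real.exp_pos _), Complex.real_smul]
    push_cast
    ring
  rw [← integrable_indicator_iff measurableSet_Ioo] at hmain
  refine hmain.congr (Filter.Eventually.of_forall fun u => ?_)
  by_cases hu : u ∈ Ioo (0 : ℝ) 1 <;> simp [holderKernel, hG, hu]

/-- The kernel of the Cesàro operator: the indicator function of `(0, 1)`. -/
def cesaroKernel : ℝ → ℂ := (Ioo (0 : ℝ) 1).indicator fun _ => 1

theorem cesaroKernel_spec : HausdorffKernel cesaroKernel := by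
  have h := holderKernel_spec (α := 1) (by norm_num)
  have e : holderKernel 1 = cesaroKernel := by
    funext u
    simp [holderKernel, cesaroKernel]
  rwa [e] at h

/-- The Hölder mean `(H_α f)(x) = Γ(α)⁻¹ ∫_0^1 (log (1/u))^{α-1} f(u x) du` on `L²(ℝ)`,
for `Re α > 0`. -/
def holderOp (α : ℂ) (hα : 0 < α.re) : L2R →L[ℂ] L2R :=
  hausdorffOp (holderKernel α) (holderKernel_spec hα)

/-- The continuous Cesàro operator `(𝒞 f)(x) = ∫_0^1 f(u x) du = (1/x) ∫_0^x f(t) dt`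
on `L²(ℝ)`. -/
def cesaroOp : L2R →L[ℂ] L2R :=
  hausdorffOp cesaroKernel cesaroKernel_spec

theorem holderOp_coeFn (α : ℂ) (hα : 0 < α.re) (f : L2R) :
    holderOp α hα f =ᵐ[volume] fun x =>
      (Complex.Gamma α)⁻¹ * ∫ u in (0 : ℝ)..1, ((Real.log u⁻¹ : ℝ) : ℂ) ^ (α - 1) * f (u * x) := by
  filter_upwards [hausdorffOp_coeFn _ (holderKernel_spec hα) f] with x hx
  rw [holderOp, hx, intervalIntegral.integral_of_le zero_le_one, integral_Ioc_eq_integral_Ioo,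
    ← integral_const_mul, ← integral_indicator measurableSet_Ioo]
  congr 1
  funext u
  by_cases hu : u ∈ Ioo (0 : ℝ) 1 <;> simp [holderKernel, hu, mul_assoc]

theorem cesaroOp_coeFn (f : L2R) :
    cesaroOp f =ᵐ[volume] fun x => (x : ℂ)⁻¹ * ∫ t in (0 : ℝ)..x, f t := by
  filter_upwards [hausdorffOp_coeFn _ cesaroKernel_spec f, HausdorffKernel.ae_ne_zero] with x hx h0
  have h1 : ∫ u : ℝ, cesaroKernel u * f (u * x) = ∫ u in (0 : ℝ)..1, f (u * x) := by
    rw [intervalIntegral.integral_of_le zero_le_one, integral_Ioc_eq_integral_Ioo,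
      ← integral_indicator measurableSet_Ioo]
    congr 1
    funext u
    by_cases hu : u ∈ Ioo (0 : ℝ) 1 <;> simp [cesaroKernel, hu]
  rw [cesaroOp, hx, h1, intervalIntegral.integral_comp_mul_right _ h0]
  simp

/-- The fractional power `𝒞^α` in the continuous functional calculus of the normal operator `𝒞`,
for the function `z ↦ z^α` with the principal branch (`1^α = 1`) and, for `Re α > 0`, `0^α = 0`. -/
def cesaroPow (α : ℂ) : L2R →L[ℂ] L2R := cfc (fun z : ℂ => z ^ α) cesaroOp

end

noncomputable section

/-! The core is the identity `holderOp α hα = cesaroPow α` (`holderOp_eq_cesaroPow`); spectrum and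
norm then follow from the functional calculus on an explicit circle.

Hausdorff operators compose by multiplicative convolution of kernels (`hausdorffOp_mul`), and the
adjoint has an explicit kernel. For 𝒞 this gives 𝒞𝒞* = 𝒞*𝒞 = 𝒞 + 𝒞*, so 𝒞 - 1 is unitary and the
spectrum lies on 𝕋 + 1. It is the whole circle, because x^(q-1) cut off to (0,1) is almost an
eigenfunction for 1/q as Re q decreases to 1/2.

Formally 𝒞 multiplies x^(1/z-1) by z, and the operator with kernel K on (0,1) multiplies it by ∫
K(u) u^(1/z-1) du, the symbol of K. To show that this operator is the symbol applied to 𝒞, take K =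
u^n first: the operator P satisfies P(1 + n𝒞) = 𝒞, and the symbol is z/(1 + nz). Linearity gives
polynomials. Operator norm and symbol are both bounded by ∫ |K(u)| |u|^(-1/2) du, and polynomials
are dense for that norm (`hausdorffOp_eq_cfc`). For the Hölder kernel, u = e^(-t) makes the symbol a
Gamma integral with value z^α.

Spectral mapping then gives the spectrum. With z = 2 cos t · e^(it), the norm is the maximum of (2
cos t)^(Re α) e^(-t Im α), attained at t = -arg α. -/

/-! ### Linearity and norm bound of Hausdorff operators in the kernel -/

theorem HausdorffKernel.norm {K : ℝ → ℂ} (hK : HausdorffKernel K) :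
    HausdorffKernel (fun u => ((‖K u‖ : ℝ) : ℂ)) := by
  refine (Integrable.norm hK).ofReal.congr (Filter.Eventually.of_forall fun u => ?_)
  simp [abs_of_nonneg (Real.rpow_nonneg (abs_nonneg u) _)]

theorem HausdorffKernel.add {K L : ℝ → ℂ} (hK : HausdorffKernel K) (hL : HausdorffKernel L) :
    HausdorffKernel (fun u => K u + L u) := by
  refine (Integrable.add hK hL).congr (Filter.Eventually.of_forall fun u => ?_)
  simp [add_mul]

theorem HausdorffKernel.const_mul {K : ℝ → ℂ} (hK : HausdorffKernel K) (c : ℂ) :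
    HausdorffKernel (fun u => c * K u) := by
  refine (Integrable.const_mul hK c).congr (Filter.Eventually.of_forall fun u => ?_)
  simp [mul_assoc]

theorem hausdorffOp_congr {K L : ℝ → ℂ} (hK : HausdorffKernel K) (hL : HausdorffKernel L)
    (h : K =ᵐ[volume] L) : hausdorffOp K hK = hausdorffOp L hL := by
  ext1 f
  apply Lp.ext
  filter_upwards [hausdorffOp_coeFn K hK f, hausdorffOp_coeFn L hL f] with x h1 h2
  rw [h1, h2]
  apply integral_congr_ae
  filter_upwards [h] with u hu
  rw [hu]

theorem hausdorffOp_add {K L : ℝ → ℂ} (hK : HausdorffKernel K) (hL : HausdorffKernel L) :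
    hausdorffOp (fun u => K u + L u) (hK.add hL) = hausdorffOp K hK + hausdorffOp L hL := by
  ext1 f
  apply Lp.ext
  rw [add_apply]
  filter_upwards [hausdorffOp_coeFn _ (hK.add hL) f, hausdorffOp_coeFn K hK f,
    hausdorffOp_coeFn L hL f, Lp.coeFn_add (hausdorffOp K hK f) (hausdorffOp L hL f),
    hK.integrable_ae f, hL.integrable_ae f] with x h1 h2 h3 h4 h5 h6
  rw [h1, h4, Pi.add_apply, h2, h3, ← integral_add h5 h6]
  simp only [add_mul]

theorem hausdorffOp_const_mul {K : ℝ → ℂ} (hK : HausdorffKernel K) (c : ℂ) :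
    hausdorffOp (fun u => c * K u) (hK.const_mul c) = c • hausdorffOp K hK := by
  ext1 f
  apply Lp.ext
  rw [smul_apply]
  filter_upwards [hausdorffOp_coeFn _ (hK.const_mul c) f, hausdorffOp_coeFn K hK f,
    Lp.coeFn_smul c (hausdorffOp K hK f)] with x h1 h2 h4
  rw [h1, h4, Pi.smul_apply, h2, smul_eq_mul, ← integral_const_mul]
  simp only [mul_assoc]

/-- The constant `bound K` built into `hausdorffOp`, rewritten as a Bochner integral. It makes the
operator continuous in K for the weighted L¹ norm, which the density argument needs. -/
theorem norm_hausdorffOp_le {K : ℝ → ℂ} (hK : HausdorffKernel K) :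
    ‖hausdorffOp K hK‖ ≤ ∫ u : ℝ, ‖K u‖ * |u| ^ (-(1 / 2) : ℝ) := by
  refine (LinearMap.mkContinuous_norm_le _ ENNReal.toReal_nonneg _).trans (le_of_eq ?_)
  have h := integral_norm_eq_lintegral_enorm hK.1
  rw [show (fun u : ℝ => ‖K u‖ * |u| ^ (-(1 / 2) : ℝ)) =
    fun u : ℝ => ‖K u * ((|u| ^ (-(1 / 2) : ℝ) : ℝ) : ℂ)‖ by
      funext u
      rw [norm_mul, Complex.norm_real, Real.norm_of_nonneg (Real.rpow_nonneg (abs_nonneg u) _)], h]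
  congr 1
  apply lintegral_congr_ae
  filter_upwards [HausdorffKernel.ae_ne_zero] with u hu
  have hpos : 0 < |u| := abs_pos.mpr hu
  rw [enorm_mul, ← ENNReal.ofReal_inv_of_pos (Real.rpow_pos_of_pos hpos _),
    ← Real.rpow_neg hpos.le, ← ofReal_norm (_ : ℂ), ← ofReal_norm (((_ : ℝ) : ℂ)),
    Complex.norm_real, Real.norm_of_nonneg (Real.rpow_nonneg hpos.le _)]

/-! ### Composition and adjoints via Fubini -/

/-- This is the operator with kernel |K| applied to |f|. It supplies the absolute integrability
behind both uses of Fubini. -/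
theorem HausdorffKernel.memLp_integral_norm {K : ℝ → ℂ} (hK : HausdorffKernel K) (f : L2R) :
    MemLp (fun x : ℝ => ∫ u : ℝ, ‖K u‖ * ‖f (u * x)‖) 2 volume := by
  have hf : MemLp (fun x => ((‖f x‖ : ℝ) : ℂ)) 2 volume := (Lp.memLp f).norm.ofReal
  have h := (hK.norm.memLp hf.toLp).norm
  refine h.ae_eq ?_
  filter_upwards [HausdorffKernel.ae_ne_zero] with x hx
  rw [HausdorffKernel.hausdorffFun_congr hf.coeFn_toLp hx]
  simp only [hausdorffFun, ← Complex.ofReal_mul]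
  rw [integral_complex_ofReal, Complex.norm_real, Real.norm_of_nonneg]
  exact integral_nonneg fun u => by positivity

theorem HausdorffKernel.ae_comp_mul_right {p : ℝ → Prop} (h : ∀ᵐ x : ℝ, p x) {x : ℝ}
    (hx : x ≠ 0) : ∀ᵐ u : ℝ, p (u * x) := by
  have hq : Measure.QuasiMeasurePreserving (fun u : ℝ => u * x) volume volume := by
    refine ⟨by fun_prop, ?_⟩
    rw [Real.map_volume_mul_right hx]
    exact Measure.smul_absolutelyContinuous
  exact hq.ae h

theorem HausdorffKernel.integrable_ae_of_memLp {K g : ℝ → ℂ} (hK : HausdorffKernel K)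
    (hg : MemLp g 2 volume) : ∀ᵐ x : ℝ, Integrable (fun u : ℝ => K u * g (u * x)) volume := by
  filter_upwards [hK.integrable_ae hg.toLp, HausdorffKernel.ae_ne_zero] with x h hx
  refine h.congr ?_
  filter_upwards [HausdorffKernel.ae_comp_mul_right hg.coeFn_toLp hx] with u hu
  rw [hu]

/-- The substitution `t = u x` in a Hausdorff integral. -/
theorem integral_mul_comp_mul (K g : ℝ → ℂ) {x : ℝ} (hx : x ≠ 0) :
    ∫ u : ℝ, K u * g (u * x) = ∫ t : ℝ, K (t / x) * ((|x|⁻¹ : ℝ) : ℂ) * g t := by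
  have h := Measure.integral_comp_div (fun u : ℝ => K u * g (u * x)) x
  have hx' : |x| ≠ 0 := abs_ne_zero.mpr hx
  calc ∫ u : ℝ, K u * g (u * x)
      = |x|⁻¹ • (|x| • ∫ u : ℝ, K u * g (u * x)) := by rw [inv_smul_smul₀ hx']
    _ = ∫ t : ℝ, K (t / x) * ((|x|⁻¹ : ℝ) : ℂ) * g t := by
        rw [← h, ← integral_smul]
        congr 1
        funext t
        rw [div_mul_cancel₀ _ hx, Complex.real_smul]
        ring

theorem integrable_mul_comp_div {K g : ℝ → ℂ} {x : ℝ} (hx : x ≠ 0)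
    (h : Integrable (fun u : ℝ => K u * g (u * x)) volume) :
    Integrable (fun t : ℝ => K (t / x) * ((|x|⁻¹ : ℝ) : ℂ) * g t) volume := by
  refine ((h.comp_div hx).const_mul ((|x|⁻¹ : ℝ) : ℂ)).congr
    (Filter.Eventually.of_forall fun t => ?_)
  simp only [div_mul_cancel₀ _ hx]
  ring

theorem integral_norm_mul_comp_mul (K g : ℝ → ℂ) {x : ℝ} (hx : x ≠ 0) :
    ∫ t : ℝ, ‖K (t / x) * ((|x|⁻¹ : ℝ) : ℂ) * g t‖ = ∫ u : ℝ, ‖K u‖ * ‖g (u * x)‖ := by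
  have h := integral_mul_comp_mul (fun u => (‖K u‖ : ℂ)) (fun u => (‖g u‖ : ℂ)) hx
  rw [← Complex.ofReal_inj, ← integral_complex_ofReal, ← integral_complex_ofReal]
  simp only [norm_mul, Complex.norm_real, Complex.ofReal_mul, norm_inv, norm_abs_eq_norm] at h ⊢
  simp only [Real.norm_eq_abs]
  exact h.symm

/-- Hausdorff operators compose by multiplicative convolution of their kernels. -/
theorem hausdorffOp_mul {K L M : ℝ → ℂ} (hK : HausdorffKernel K) (hL : HausdorffKernel L)
    (hM : HausdorffKernel M) (hLm : Measurable L)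
    (h : ∀ᵐ w : ℝ, ∫ u : ℝ, K u * (L (w / u) * ((|u|⁻¹ : ℝ) : ℂ)) = M w) :
    hausdorffOp K hK * hausdorffOp L hL = hausdorffOp M hM := by
  ext1 f
  apply Lp.ext
  have hf : StronglyMeasurable f := Lp.stronglyMeasurable f
  have hF := hL.memLp_integral_norm f
  have hLf := hausdorffOp_coeFn L hL f
  rw [mul_apply_eq_comp]
  filter_upwards [hausdorffOp_coeFn K hK (hausdorffOp L hL f), hausdorffOp_coeFn M hM f,
    HausdorffKernel.ae_ne_zero, hK.integrable_ae_of_memLp (MemLp.ofReal (K := ℂ) hF)]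
    with x h1 h2 hx h3
  rw [h1, h2]
  set G : ℝ → ℝ → ℂ := fun u w => K u * (L (w / u) * ((|u|⁻¹ : ℝ) : ℂ) * f (w * x)) with hG
  -- Integrating |G u w| over w gives |K u| times the |L|-mean of |f| at u x. That mean is in L², so
  -- for almost every x the result is integrable in u.
  have hGi : Integrable (Function.uncurry G) (volume.prod volume) := by
    rw [integrable_prod_iff]
    · constructor
      · filter_upwards [HausdorffKernel.ae_ne_zero,
          HausdorffKernel.ae_comp_mul_right (hL.integrable_ae f) hx] with u hu hi
        refine (integrable_mul_comp_div (g := fun w => f (w * x)) hu ?_).const_mul (K u)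
        simpa only [mul_assoc] using hi
      · refine (Integrable.norm h3).congr ?_
        filter_upwards [HausdorffKernel.ae_ne_zero] with u hu
        have e := integral_norm_mul_comp_mul L (fun w => f (w * x)) hu
        simp only [Function.uncurry_apply_pair, hG]
        simp only [norm_mul (K u)]
        rw [integral_const_mul, e, RCLike.norm_ofReal, abs_of_nonneg
          (integral_nonneg fun u => by positivity)]
        simp only [mul_assoc]
    · have m1 : Measurable fun p : ℝ × ℝ => L (p.2 / p.1) * ((|p.1|⁻¹ : ℝ) : ℂ) := by
        fun_prop
      exact hK.aestronglyMeasurable.comp_fst.mul (m1.aestronglyMeasurable.mul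
        (hf.comp_measurable (by fun_prop : Measurable fun p : ℝ × ℝ => p.2 * x)).aestronglyMeasurable)
  calc ∫ u : ℝ, K u * hausdorffOp L hL f (u * x)
      = ∫ u : ℝ, ∫ w : ℝ, G u w := by
        apply integral_congr_ae
        filter_upwards [HausdorffKernel.ae_comp_mul_right hLf hx, HausdorffKernel.ae_ne_zero]
          with u hu h0
        have e := integral_mul_comp_mul L (fun w => f (w * x)) h0
        rw [hu, integral_const_mul, ← e]
        simp only [mul_assoc]
    _ = ∫ w : ℝ, ∫ u : ℝ, G u w := integral_integral_swap hGi
    _ = ∫ w : ℝ, M w * f (w * x) := by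
        apply integral_congr_ae
        filter_upwards [h] with w hw
        rw [← hw, ← integral_mul_const]
        simp only [hG, mul_assoc]

/-- With t = u x, K becomes the integral kernel K(t/x)/|x|. Its conjugate transpose has the same
form, L(x/t)/|t|, exactly when L is given by `h` at v = x/t. -/
theorem hausdorffOp_eq_adjoint {K L : ℝ → ℂ} (hK : HausdorffKernel K) (hL : HausdorffKernel L)
    (hKm : Measurable K)
    (h : ∀ᵐ v : ℝ, L v = star (K v⁻¹) * ((|v|⁻¹ : ℝ) : ℂ)) :
    hausdorffOp L hL = star (hausdorffOp K hK) := by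
  rw [ContinuousLinearMap.star_eq_adjoint, ContinuousLinearMap.eq_adjoint_iff]
  intro g f
  rw [L2.inner_def, L2.inner_def]
  have hf : StronglyMeasurable f := Lp.stronglyMeasurable f
  have hg : StronglyMeasurable g := Lp.stronglyMeasurable g
  set G : ℝ → ℝ → ℂ := fun x t => star (g x) * (K (t / x) * ((|x|⁻¹ : ℝ) : ℂ) * f t) with hG
  -- Integrating |G x t| over t leaves |g x| times the |K|-mean of |f| at x, a product of two L²
  -- functions.
  have hGi : Integrable (Function.uncurry G) (volume.prod volume) := by
    rw [integrable_prod_iff]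
    · constructor
      · filter_upwards [HausdorffKernel.ae_ne_zero, hK.integrable_ae f] with x hx hi
        exact (integrable_mul_comp_div hx hi).const_mul (star (g x))
      · refine ((Lp.memLp g).norm.integrable_mul (hK.memLp_integral_norm f)).congr ?_
        filter_upwards [HausdorffKernel.ae_ne_zero] with x hx
        simp only [Function.uncurry_apply_pair, hG, Pi.mul_apply]
        simp only [norm_mul (star _), norm_star]
        rw [integral_const_mul, integral_norm_mul_comp_mul K f hx]
    · have m1 : Measurable fun p : ℝ × ℝ => K (p.2 / p.1) * ((|p.1|⁻¹ : ℝ) : ℂ) := by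
        fun_prop
      exact (hg.aestronglyMeasurable.comp_fst.star).mul (m1.aestronglyMeasurable.mul
        (hf.comp_measurable measurable_snd).aestronglyMeasurable)
  symm
  calc ∫ x : ℝ, inner ℂ (g x) (hausdorffOp K hK f x)
      = ∫ x : ℝ, ∫ t : ℝ, G x t := by
        apply integral_congr_ae
        filter_upwards [hausdorffOp_coeFn K hK f, HausdorffKernel.ae_ne_zero] with x hx h0
        rw [hx, integral_mul_comp_mul K f h0, RCLike.inner_apply', integral_const_mul]
        rfl
    _ = ∫ t : ℝ, ∫ x : ℝ, G x t := integral_integral_swap hGi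
    _ = ∫ t : ℝ, inner ℂ (hausdorffOp L hL g t) (f t) := by
        apply integral_congr_ae
        filter_upwards [hausdorffOp_coeFn L hL g, HausdorffKernel.ae_ne_zero] with t ht h0
        rw [ht, integral_mul_comp_mul L g h0, RCLike.inner_apply', ← integral_conj,
          ← integral_mul_const]
        apply integral_congr_ae
        have hq : ∀ᵐ x : ℝ, L (x / t) = star (K (x / t)⁻¹) * ((|x / t|⁻¹ : ℝ) : ℂ) := by
          simp only [div_eq_mul_inv]
          exact HausdorffKernel.ae_comp_mul_right h (inv_ne_zero h0)
        filter_upwards [hq, HausdorffKernel.ae_ne_zero] with x hx hx0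
        have ht' : ((|t| : ℝ) : ℂ) ≠ 0 := by simpa using h0
        rw [hx]
        simp only [hG, map_mul, Complex.conj_ofReal, inv_div, abs_div, Complex.star_def,
          Complex.conj_conj]
        push_cast
        field_simp

/-! ### Normality of 𝒞 and unitarity of 𝒞 - 1 -/

/-- The kernel of the adjoint of the Cesàro operator: `v⁻¹` for `v > 1`, and `0` otherwise. -/
def cesaroAdjKernel : ℝ → ℂ := (Ioi (1 : ℝ)).indicator fun v => ((v⁻¹ : ℝ) : ℂ)

theorem cesaroAdjKernel_spec : HausdorffKernel cesaroAdjKernel := by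
  have h := (integrableOn_Ioi_rpow_of_lt (a := -(3 / 2)) (by norm_num) one_pos).ofReal (𝕜 := ℂ)
  replace h := (integrable_indicator_iff measurableSet_Ioi).mpr h
  refine h.congr (Filter.Eventually.of_forall fun u => ?_)
  by_cases hu : u ∈ Ioi (1 : ℝ)
  · have hu0 : 0 < u := zero_lt_one.trans hu
    simp only [cesaroAdjKernel, indicator_of_mem hu]
    rw [abs_of_pos hu0, ← Complex.ofReal_mul, ← Real.rpow_neg_one u, ← Real.rpow_add hu0]
    norm_num
  · simp [cesaroAdjKernel, hu]

theorem measurable_cesaroKernel : Measurable cesaroKernel :=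
  measurable_const.indicator measurableSet_Ioo

theorem measurable_cesaroAdjKernel : Measurable cesaroAdjKernel :=
  Measurable.indicator (by fun_prop) measurableSet_Ioi

theorem star_cesaroOp : star cesaroOp = hausdorffOp cesaroAdjKernel cesaroAdjKernel_spec := by
  refine (hausdorffOp_eq_adjoint _ _ measurable_cesaroKernel ?_).symm
  filter_upwards [HausdorffKernel.ae_ne_zero] with v hv
  by_cases h1 : 1 < v
  · have h0 : 0 < v := zero_lt_one.trans h1
    have : v⁻¹ ∈ Ioo (0 : ℝ) 1 := ⟨inv_pos.mpr h0, inv_lt_one_of_one_lt₀ h1⟩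
    simp only [cesaroAdjKernel, cesaroKernel, indicator_of_mem this,
      indicator_of_mem (show v ∈ Ioi (1 : ℝ) from h1), abs_of_pos h0, star_one, one_mul]
  · have : v⁻¹ ∉ Ioo (0 : ℝ) 1 := by
      rintro ⟨h2, h3⟩
      exact h1 ((inv_lt_one₀ (inv_pos.mp h2)).mp h3)
    simp [cesaroAdjKernel, cesaroKernel, indicator_of_notMem this,
      indicator_of_notMem (show v ∉ Ioi (1 : ℝ) from h1)]

theorem ae_ne_one : ∀ᵐ u : ℝ, u ≠ 1 := by
  simp [ae_iff]

/-- For w > 0 the convolution of the kernels is w⁻¹ · min(1, w): this is 1 for w < 1 and w⁻¹ for w >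
1, the sum of the two kernels. For w < 0 everything vanishes. -/
theorem cesaroOp_mul_star : cesaroOp * star cesaroOp = cesaroOp + star cesaroOp := by
  rw [star_cesaroOp, cesaroOp, ← hausdorffOp_add]
  refine hausdorffOp_mul _ _ _ measurable_cesaroAdjKernel ?_
  filter_upwards [HausdorffKernel.ae_ne_zero, ae_ne_one] with w h0 h1
  have e : (fun u : ℝ => cesaroKernel u * (cesaroAdjKernel (w / u) * ((|u|⁻¹ : ℝ) : ℂ))) =
      (Ioo (0 : ℝ) (min 1 w)).indicator fun _ => ((w⁻¹ : ℝ) : ℂ) := by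
    funext u
    by_cases hu : u ∈ Ioo (0 : ℝ) 1
    · have hu0 : 0 < u := hu.1
      by_cases hw : u < w
      · have h2 : w / u ∈ Ioi (1 : ℝ) := (one_lt_div hu0).mpr hw
        rw [indicator_of_mem (show u ∈ Ioo (0 : ℝ) (min 1 w) from ⟨hu0, lt_min hu.2 hw⟩),
          cesaroKernel, cesaroAdjKernel, indicator_of_mem hu, indicator_of_mem h2,
          abs_of_pos hu0, one_mul, ← Complex.ofReal_mul]
        congr 1
        field_simp
      · have h2 : w / u ∉ Ioi (1 : ℝ) := fun h => hw ((one_lt_div hu0).mp h)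
        rw [indicator_of_notMem (fun h => hw (lt_min_iff.mp h.2).2), cesaroAdjKernel,
          indicator_of_notMem h2]
        simp
    · rw [indicator_of_notMem (fun h => hu ⟨h.1, (lt_min_iff.mp h.2).1⟩), cesaroKernel,
        indicator_of_notMem hu, zero_mul]
  rw [e, integral_indicator measurableSet_Ioo, setIntegral_const, measureReal_def, Real.volume_Ioo]
  rcases lt_or_gt_of_ne h0 with h | h
  · have hm : min 1 w - 0 ≤ 0 := by simp [h.le]
    rw [ENNReal.ofReal_of_nonpos hm]
    simp [cesaroKernel, cesaroAdjKernel, h.not_gt, (h.trans one_pos).not_gt]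
  · rcases lt_or_gt_of_ne h1 with h' | h'
    · simp [cesaroKernel, cesaroAdjKernel, h, h', h'.le, h.le, h'.not_gt, h0]
    · simp [cesaroKernel, cesaroAdjKernel, h, h', h'.le, h'.not_gt]

/-- Here the convolution at w > 0 is the integral of u⁻² over u > max(1, w), which is 1/max(1, w),
the same function as for the other order. -/
theorem star_mul_cesaroOp : star cesaroOp * cesaroOp = cesaroOp + star cesaroOp := by
  rw [star_cesaroOp, cesaroOp, ← hausdorffOp_add]
  refine hausdorffOp_mul _ _ _ measurable_cesaroKernel ?_
  filter_upwards [HausdorffKernel.ae_ne_zero, ae_ne_one] with w h0 h1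
  rcases lt_or_gt_of_ne h0 with h | h
  · have e : (fun u : ℝ => cesaroAdjKernel u * (cesaroKernel (w / u) * ((|u|⁻¹ : ℝ) : ℂ))) =
        fun _ => 0 := by
      funext u
      by_cases hu : u ∈ Ioi (1 : ℝ)
      · have h2 : w / u ∉ Ioo (0 : ℝ) 1 := fun h2 =>
          (div_neg_of_neg_of_pos h (zero_lt_one.trans hu)).not_gt h2.1
        rw [cesaroKernel, indicator_of_notMem h2]
        simp
      · rw [cesaroAdjKernel, indicator_of_notMem hu, zero_mul]
    rw [e]
    simp [cesaroKernel, cesaroAdjKernel, h.not_gt, (h.trans one_pos).not_gt]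
  · have hm : 0 < max 1 w := lt_max_of_lt_left one_pos
    have e : (fun u : ℝ => cesaroAdjKernel u * (cesaroKernel (w / u) * ((|u|⁻¹ : ℝ) : ℂ))) =
        (Ioi (max 1 w)).indicator fun u => ((u ^ (-2 : ℝ) : ℝ) : ℂ) := by
      funext u
      by_cases hu : u ∈ Ioi (1 : ℝ)
      · have hu0 : 0 < u := zero_lt_one.trans hu
        by_cases hw : w < u
        · have h2 : w / u ∈ Ioo (0 : ℝ) 1 := ⟨div_pos h hu0, (div_lt_one hu0).mpr hw⟩
          rw [indicator_of_mem (show u ∈ Ioi (max 1 w) from max_lt hu hw),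
            cesaroKernel, cesaroAdjKernel, indicator_of_mem hu, indicator_of_mem h2,
            abs_of_pos hu0, one_mul, ← Complex.ofReal_mul, Real.rpow_neg hu0.le, Real.rpow_two]
          congr 1
          field_simp
        · have h2 : w / u ∉ Ioo (0 : ℝ) 1 := fun h2 => hw ((div_lt_one hu0).mp h2.2)
          rw [indicator_of_notMem (fun h : u ∈ Ioi (max 1 w) => hw (max_lt_iff.mp h).2), cesaroKernel,
            indicator_of_notMem h2]
          simp
      · rw [indicator_of_notMem (fun h : u ∈ Ioi (max 1 w) =>
          hu (mem_Ioi.mpr (max_lt_iff.mp (mem_Ioi.mp h)).1)), cesaroAdjKernel,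
          indicator_of_notMem hu, zero_mul]
    rw [e, integral_indicator measurableSet_Ioi, integral_complex_ofReal,
      integral_Ioi_rpow_of_lt (by norm_num) hm]
    have e2 : -(max 1 w) ^ ((-2 : ℝ) + 1) / (-2 + 1) = (max 1 w)⁻¹ := by
      rw [show (-2 : ℝ) + 1 = -1 by norm_num, Real.rpow_neg_one]
      ring
    rw [e2]
    rcases lt_or_gt_of_ne h1 with h' | h'
    · simp [cesaroKernel, cesaroAdjKernel, h, h', h'.le, h'.not_gt]
    · simp [cesaroKernel, cesaroAdjKernel, h, h', h'.le, h'.not_gt]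

instance isStarNormal_cesaroOp : IsStarNormal cesaroOp :=
  ⟨by rw [commute_iff_eq, cesaroOp_mul_star, star_mul_cesaroOp]⟩

theorem cesaroOp_sub_one_mem_unitary : cesaroOp - 1 ∈ unitary (L2R →L[ℂ] L2R) := by
  rw [Unitary.mem_iff, star_sub, star_one]
  constructor
  · rw [sub_mul, mul_sub, star_mul_cesaroOp]
    simp
  · rw [sub_mul, mul_sub, cesaroOp_mul_star]
    simp

theorem norm_sub_one_of_mem_spectrum_cesaroOp {z : ℂ} (hz : z ∈ spectrum ℂ cesaroOp) :
    ‖z - 1‖ = 1 := by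
  have h := spectrum.subset_circle_of_unitary (𝕜 := ℂ) cesaroOp_sub_one_mem_unitary
  have h2 : z - 1 ∈ spectrum ℂ (cesaroOp - 1) := by
    have h3 := spectrum.sub_singleton_eq cesaroOp (1 : ℂ)
    rw [map_one] at h3
    rw [← h3]
    exact Set.sub_mem_sub hz rfl
  simpa using h h2

/-! ### Approximate eigenfunctions and the full spectrum of 𝒞 -/

/-- The function `x ^ (q - 1)` on `(0, 1)`, extended by zero. -/
def truncPow (q : ℂ) : ℝ → ℂ := (Ioo (0 : ℝ) 1).indicator fun x => (x : ℂ) ^ (q - 1)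

theorem truncPow_norm_sq (q : ℂ) :
    (fun x => ‖truncPow q x‖ ^ 2) = (Ioo (0 : ℝ) 1).indicator fun x => x ^ (2 * q.re - 2) := by
  funext x
  by_cases hx : x ∈ Ioo (0 : ℝ) 1
  · simp only [truncPow, indicator_of_mem hx]
    rw [Complex.norm_cpow_eq_rpow_re_of_pos hx.1, ← Real.rpow_natCast, ← Real.rpow_mul hx.1.le]
    congr 1
    simp
    ring
  · simp [truncPow, hx]

theorem memLp_truncPow {q : ℂ} (hq : 1 / 2 < q.re) : MemLp (truncPow q) 2 volume := by
  rw [memLp_two_iff_integrable_sq_norm, truncPow_norm_sq, integrable_indicator_iff measurableSet_Ioo]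
  · exact (intervalIntegral.integrableOn_Ioo_rpow_iff one_pos).mpr (by linarith)
  · exact (Measurable.indicator (by fun_prop) measurableSet_Ioo).aestronglyMeasurable

theorem norm_toLp_sq {f : ℝ → ℂ} (hf : MemLp f 2 volume) : ‖hf.toLp‖ ^ 2 = ∫ x, ‖f x‖ ^ 2 := by
  have h : inner ℂ hf.toLp hf.toLp = ((‖hf.toLp‖ ^ 2 : ℝ) : ℂ) := by
    rw [inner_self_eq_norm_sq_to_K]
    push_cast
    rfl
  rw [L2.inner_def] at h
  rw [← Complex.ofReal_inj, ← h, ← integral_complex_ofReal]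
  apply integral_congr_ae
  filter_upwards [hf.coeFn_toLp] with x hx
  rw [hx, inner_self_eq_norm_sq_to_K]
  push_cast
  rfl

theorem norm_sq_truncPow {q : ℂ} (hq : 1 / 2 < q.re) :
    ‖(memLp_truncPow hq).toLp‖ ^ 2 = (2 * q.re - 1)⁻¹ := by
  rw [norm_toLp_sq, truncPow_norm_sq, integral_indicator measurableSet_Ioo,
    ← integral_Ioc_eq_integral_Ioo, ← intervalIntegral.integral_of_le zero_le_one,
    integral_rpow (Or.inl (by linarith)), Real.one_rpow, Real.zero_rpow (by linarith)]
  rw [show 2 * q.re - 2 + 1 = 2 * q.re - 1 by ring]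
  simp

theorem memLp_cesaroAdjKernel : MemLp cesaroAdjKernel 2 volume := by
  rw [memLp_two_iff_integrable_sq_norm measurable_cesaroAdjKernel.aestronglyMeasurable]
  have h := integrableOn_Ioi_rpow_of_lt (a := -2) (by norm_num) one_pos
  replace h := (integrable_indicator_iff measurableSet_Ioi).mpr h
  refine h.congr (Filter.Eventually.of_forall fun u => ?_)
  by_cases hu : u ∈ Ioi (1 : ℝ)
  · have hu0 : 0 < u := zero_lt_one.trans hu
    simp only [cesaroAdjKernel, indicator_of_mem hu]
    rw [Complex.norm_real, Real.norm_of_nonneg (inv_nonneg.mpr hu0.le), Real.rpow_neg hu0.le,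
      Real.rpow_two, inv_pow]
  · simp [cesaroAdjKernel, hu]

theorem integral_truncPow {q : ℂ} (hq : 0 < q.re) {x : ℝ} (hx : 0 ≤ x) :
    ∫ t in (0 : ℝ)..x, truncPow q t = ((min x 1 : ℝ) : ℂ) ^ q / q := by
  have h0 : q ≠ 0 := fun h => by simp [h] at hq
  have hm : 0 ≤ min x 1 := le_min hx zero_le_one
  have h := integral_cpow (a := 0) (b := min x 1) (r := q - 1) (Or.inl (by simpa using hq))
  rw [sub_add_cancel, Complex.ofReal_zero, Complex.zero_cpow h0, sub_zero] at h
  rw [← h, intervalIntegral.integral_of_le hx, intervalIntegral.integral_of_le hm,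
    integral_Ioc_eq_integral_Ioo, integral_Ioc_eq_integral_Ioo, truncPow,
    setIntegral_indicator measurableSet_Ioo, Ioo_inter_Ioo, max_self]

/-- On (0,1) the power x^(q-1) is an eigenfunction for 1/q. The cutoff adds only the tail q⁻¹x⁻¹ on
x > 1; before the factor q⁻¹, its norm does not depend on q, whereas the norm of the truncated power
blows up as Re q tends to 1/2. -/
theorem cesaroOp_truncPow {q : ℂ} (hq : 1 / 2 < q.re) :
    cesaroOp (memLp_truncPow hq).toLp =
      q⁻¹ • ((memLp_truncPow hq).toLp + memLp_cesaroAdjKernel.toLp) := by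
  have hq0 : 0 < q.re := by linarith
  have h0 : q ≠ 0 := fun h => by simp [h] at hq0
  rw [← MemLp.toLp_add, ← MemLp.toLp_const_smul]
  apply Lp.ext
  filter_upwards [cesaroOp_coeFn (memLp_truncPow hq).toLp, HausdorffKernel.ae_ne_zero, ae_ne_one,
    (((memLp_truncPow hq).add memLp_cesaroAdjKernel).const_smul q⁻¹).coeFn_toLp]
    with x h1 hx hx1 h2
  rw [h1, h2]
  have e : ∫ t in (0 : ℝ)..x, ((memLp_truncPow hq).toLp : L2R) t = ∫ t in (0 : ℝ)..x, truncPow q t := by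
    apply intervalIntegral.integral_congr_ae
    filter_upwards [(memLp_truncPow hq).coeFn_toLp] with t ht _
    exact ht
  rw [e, Pi.smul_apply, Pi.add_apply, smul_eq_mul]
  rcases lt_or_gt_of_ne hx with h | h
  · have e2 : ∫ t in (0 : ℝ)..x, truncPow q t = 0 := by
      rw [intervalIntegral.integral_symm, intervalIntegral.integral_of_le h.le,
        integral_Ioc_eq_integral_Ioo, truncPow, setIntegral_indicator measurableSet_Ioo,
        Ioo_inter_Ioo]
      simp [h.le]
    rw [e2]
    simp [truncPow, cesaroAdjKernel, h.not_gt, (h.trans one_pos).not_gt]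
  · rw [integral_truncPow hq0 h.le]
    have hxc : (x : ℂ) ≠ 0 := by exact_mod_cast hx
    rcases lt_or_gt_of_ne hx1 with h' | h'
    · have hn : x ∉ Ioi (1 : ℝ) := h'.not_gt
      rw [truncPow, cesaroAdjKernel, indicator_of_mem (show x ∈ Ioo (0 : ℝ) 1 from ⟨h, h'⟩),
        indicator_of_notMem hn, min_eq_left h'.le, Complex.cpow_sub _ _ hxc, Complex.cpow_one,
        add_zero]
      field_simp
    · have hn : x ∉ Ioo (0 : ℝ) 1 := fun hn => h'.not_gt hn.2
      rw [truncPow, cesaroAdjKernel, indicator_of_notMem hn,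
        indicator_of_mem (show x ∈ Ioi (1 : ℝ) from h'), min_eq_right h'.le, Complex.ofReal_one,
        Complex.one_cpow, zero_add]
      push_cast
      field_simp

/-- A bounded left inverse S of p⁻¹ - 𝒞 would bound the norm of the approximate eigenfunction for q
= p + δ, which can be made arbitrarily large. -/
theorem inv_mem_spectrum_cesaroOp {p : ℂ} (hp : p.re = 1 / 2) : p⁻¹ ∈ spectrum ℂ cesaroOp := by
  by_contra hz
  rw [spectrum.notMem_iff] at hz
  obtain ⟨S, hS⟩ := hz.exists_left_inv
  set H := ‖memLp_cesaroAdjKernel.toLp‖ with hH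
  -- B will be ‖g‖², since ‖g‖² = 1/(2δ). Its first term makes 4δ‖S‖ ≤ 1/2, so that ‖g‖ ≤ 4‖S‖H; the
  -- other two terms contradict this.
  set B : ℝ := 4 * ‖S‖ + 16 * ‖S‖ ^ 2 * H ^ 2 + 1 with hB
  have hS0 := norm_nonneg S
  have hBpos : 0 < B := by positivity
  set δ : ℝ := (2 * B)⁻¹ with hδ
  have hδpos : 0 < δ := by positivity
  set q : ℂ := p + δ with hqdef
  have hqre : q.re = 1 / 2 + δ := by simp [hqdef, hp]
  have hq : 1 / 2 < q.re := by linarith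
  set g := (memLp_truncPow hq).toLp with hg
  have hgn : ‖g‖ ^ 2 = B := by
    rw [hg, norm_sq_truncPow hq, hqre, show 2 * (1 / 2 + δ) - 1 = 2 * δ by ring, hδ]
    field_simp
  have hpn : 1 / 2 ≤ ‖p‖ := by
    have := Complex.abs_re_le_norm p
    rw [hp] at this
    exact (le_abs_self _).trans this
  have hqn : 1 / 2 ≤ ‖q‖ := by
    have := (le_abs_self _).trans (Complex.abs_re_le_norm q)
    linarith
  have hp0 : p ≠ 0 := norm_pos_iff.mp (by linarith)
  have hq0 : q ≠ 0 := norm_pos_iff.mp (by linarith)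
  have hpi : ‖p‖⁻¹ ≤ 2 := by
    rw [inv_le_comm₀ (by linarith) two_pos]; linarith
  have hqi : ‖q‖⁻¹ ≤ 2 := by
    rw [inv_le_comm₀ (by linarith) two_pos]; linarith
  have hdiff : ‖p⁻¹ - q⁻¹‖ ≤ 4 * δ := by
    have e : p⁻¹ - q⁻¹ = p⁻¹ * q⁻¹ * (δ : ℂ) := by
      rw [hqdef] at hq0 ⊢
      field_simp
      ring
    rw [e, norm_mul, norm_mul, norm_inv, norm_inv, Complex.norm_real, Real.norm_of_nonneg hδpos.le]
    have : ‖p‖⁻¹ * ‖q‖⁻¹ ≤ 2 * 2 := mul_le_mul hpi hqi (by positivity) (by norm_num)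
    nlinarith
  have hT : (algebraMap ℂ (L2R →L[ℂ] L2R) p⁻¹ - cesaroOp) g =
      (p⁻¹ - q⁻¹) • g - q⁻¹ • memLp_cesaroAdjKernel.toLp := by
    rw [sub_apply, Algebra.algebraMap_eq_smul_one, smul_apply, one_apply_eq_self, hg,
      cesaroOp_truncPow hq, smul_add, sub_smul]
    abel
  have hg1 : ‖g‖ ≤ ‖S‖ * (4 * δ * ‖g‖ + 2 * H) := by
    have e : g = S ((algebraMap ℂ (L2R →L[ℂ] L2R) p⁻¹ - cesaroOp) g) := by
      rw [← mul_apply_eq_comp, hS, one_apply_eq_self]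
    calc ‖g‖ = ‖S ((algebraMap ℂ (L2R →L[ℂ] L2R) p⁻¹ - cesaroOp) g)‖ := by rw [← e]
      _ ≤ ‖S‖ * ‖(algebraMap ℂ (L2R →L[ℂ] L2R) p⁻¹ - cesaroOp) g‖ := S.le_opNorm _
      _ ≤ ‖S‖ * (4 * δ * ‖g‖ + 2 * H) := by
        gcongr
        rw [hT]
        refine (norm_sub_le _ _).trans ?_
        rw [norm_smul, norm_smul, norm_inv]
        gcongr
  have h1 : ‖S‖ * (4 * δ) ≤ 1 / 2 := by
    rw [hδ, mul_inv, ← div_eq_mul_inv 2⁻¹ B, ← mul_div_assoc, ← mul_div_assoc, div_le_iff₀ hBpos]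
    have : 0 ≤ 16 * ‖S‖ ^ 2 * H ^ 2 := by positivity
    linarith
  have h2 : ‖g‖ ≤ 4 * ‖S‖ * H := by
    have := mul_le_mul_of_nonneg_right h1 (norm_nonneg g)
    linarith
  have h3 : ‖g‖ ^ 2 ≤ (4 * ‖S‖ * H) ^ 2 := pow_le_pow_left₀ (norm_nonneg g) h2 2
  rw [hgn, hB] at h3
  nlinarith

/-- The circle is |z|² = 2 Re z, which inversion maps to a vertical line. -/
theorem re_inv_of_norm_sub_one {z : ℂ} (hz : ‖z - 1‖ = 1) (h0 : z ≠ 0) : (z⁻¹).re = 1 / 2 := by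
  have h := Complex.sq_norm (z - 1)
  rw [hz, Complex.normSq_apply] at h
  simp only [Complex.sub_re, Complex.sub_im, Complex.one_re, Complex.one_im, sub_zero] at h
  have hn : Complex.normSq z = 2 * z.re := by
    rw [Complex.normSq_apply]
    linarith
  have hn0 : Complex.normSq z ≠ 0 := by simpa using h0
  rw [Complex.inv_re, hn]
  rw [hn] at hn0
  have : z.re ≠ 0 := fun h => hn0 (by simp [h])
  field_simp

theorem spectrum_cesaroOp : spectrum ℂ cesaroOp = {z : ℂ | ‖z - 1‖ = 1} := by
  apply Subset.antisymm
  · exact fun z hz => norm_sub_one_of_mem_spectrum_cesaroOp hz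
  · intro z hz
    by_cases h0 : z = 0
    · subst h0
      -- The point 0 is no inverse of a point on the line Re p = 1/2; it is reached as a limit of
      -- such inverses, since the spectrum is closed.
      have hlim : Filter.Tendsto (fun n : ℕ => ((1 / 2 : ℝ) + (n : ℝ) * Complex.I : ℂ)⁻¹)
          Filter.atTop (nhds 0) := by
        refine squeeze_zero_norm' ?_ (tendsto_inv_atTop_zero.comp tendsto_natCast_atTop_atTop)
        filter_upwards [Filter.eventually_gt_atTop 0] with n hn
        rw [norm_inv, Function.comp_apply]
        have hn' : (0 : ℝ) < n := by exact_mod_cast hn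
        refine inv_anti₀ hn' ?_
        have := (le_abs_self _).trans
          (Complex.abs_im_le_norm ((1 / 2 : ℝ) + (n : ℝ) * Complex.I : ℂ))
        simpa using this
      refine (spectrum.isClosed cesaroOp).mem_of_tendsto hlim (Filter.Eventually.of_forall fun n => ?_)
      exact inv_mem_spectrum_cesaroOp (by simp)
    · have := inv_mem_spectrum_cesaroOp (re_inv_of_norm_sub_one hz h0)
      rwa [inv_inv] at this

/-! ### The kernels u^n as rational functions of 𝒞 -/

theorem integrableOn_abs_rpow_neg_half :
    IntegrableOn (fun u : ℝ => ((|u| ^ (-(1 / 2) : ℝ) : ℝ) : ℂ)) (Icc 0 1) volume := by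
  have h : IntegrableOn (fun u : ℝ => ((|u| ^ (-(1 / 2) : ℝ) : ℝ) : ℂ)) (Ioo 0 1) volume := by
    refine ((integrable_indicator_iff measurableSet_Ioo).mp
      (Integrable.congr cesaroKernel_spec (Filter.Eventually.of_forall fun u => ?_)))
    by_cases hu : u ∈ Ioo (0 : ℝ) 1 <;> simp [cesaroKernel, hu]
  exact (integrableOn_Icc_iff_integrableOn_Ioo (by simp) (by simp)).mpr h

theorem hausdorffKernel_indicator {g : ℝ → ℂ} (hg : Continuous g) :
    HausdorffKernel ((Ioo (0 : ℝ) 1).indicator g) := by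
  have h := (integrableOn_abs_rpow_neg_half.continuousOn_mul hg.continuousOn isCompact_Icc).mono_set
    Ioo_subset_Icc_self
  refine ((integrable_indicator_iff measurableSet_Ioo).mpr h).congr
    (Filter.Eventually.of_forall fun u => ?_)
  by_cases hu : u ∈ Ioo (0 : ℝ) 1 <;> simp [hu]

theorem continuous_ofReal_pow (n : ℕ) : Continuous fun u : ℝ => (u : ℂ) ^ n := by fun_prop

/-- The operator with kernel `u ^ n` on `(0, 1)`. -/
def powOp (n : ℕ) : L2R →L[ℂ] L2R :=
  hausdorffOp _ (hausdorffKernel_indicator (continuous_ofReal_pow n))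

/-- For 0 < w < 1 the convolution is ∫ u^n du from w to 1, that is (1 - w^(n+1))/(n+1), a
combination of the two kernels. -/
theorem powOp_succ_mul_cesaroOp (n : ℕ) :
    ((n : ℂ) + 1) • (powOp (n + 1) * cesaroOp) = cesaroOp - powOp (n + 1) := by
  have hk := hausdorffKernel_indicator (continuous_ofReal_pow (n + 1))
  have hn : (n : ℂ) + 1 ≠ 0 := by exact_mod_cast n.succ_ne_zero
  have hM := (cesaroKernel_spec.add (hk.const_mul (-1))).const_mul ((n : ℂ) + 1)⁻¹
  have h : powOp (n + 1) * cesaroOp = hausdorffOp _ hM := by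
    refine hausdorffOp_mul _ _ _ measurable_cesaroKernel ?_
    filter_upwards [HausdorffKernel.ae_ne_zero, ae_ne_one] with w h0 h1
    have e : (fun u : ℝ => (Ioo (0 : ℝ) 1).indicator (fun u : ℝ => (u : ℂ) ^ (n + 1)) u *
        (cesaroKernel (w / u) * ((|u|⁻¹ : ℝ) : ℂ))) =
        (if 0 < w then Ioo w 1 else ∅).indicator fun u : ℝ => (u : ℂ) ^ n := by
      funext u
      by_cases hu : u ∈ Ioo (0 : ℝ) 1
      · have hu0 : (u : ℂ) ≠ 0 := by exact_mod_cast hu.1.ne'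
        rw [indicator_of_mem hu]
        by_cases hw : 0 < w ∧ w < u
        · have h2 : w / u ∈ Ioo (0 : ℝ) 1 := ⟨div_pos hw.1 hu.1, (div_lt_one hu.1).mpr hw.2⟩
          rw [if_pos hw.1, indicator_of_mem (show u ∈ Ioo w 1 from ⟨hw.2, hu.2⟩), cesaroKernel,
            indicator_of_mem h2, abs_of_pos hu.1]
          push_cast
          rw [one_mul, pow_succ, mul_inv_cancel_right₀ hu0]
        · have h2 : w / u ∉ Ioo (0 : ℝ) 1 := fun h2 =>
            hw ⟨(div_pos_iff_of_pos_right hu.1).mp h2.1, (div_lt_one hu.1).mp h2.2⟩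
          have h3 : u ∉ (if 0 < w then Ioo w 1 else ∅) := by
            split_ifs with h
            · exact fun h3 => hw ⟨h, h3.1⟩
            · simp
          rw [indicator_of_notMem h3, cesaroKernel, indicator_of_notMem h2]
          simp
      · have h3 : u ∉ (if 0 < w then Ioo w 1 else ∅) := by
          split_ifs with h
          · exact fun h3 => hu ⟨h.trans h3.1, h3.2⟩
          · simp
        rw [indicator_of_notMem h3, indicator_of_notMem hu, zero_mul]
    rw [e]
    by_cases hw : 0 < w
    · rw [if_pos hw, integral_indicator measurableSet_Ioo]
      rcases lt_or_gt_of_ne h1 with h' | h'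
      · have hi : ∫ u in (w : ℝ)..1, (u : ℂ) ^ n = ((n : ℂ) + 1)⁻¹ * (1 - (w : ℂ) ^ (n + 1)) := by
          have := integral_pow (a := w) (b := 1) n
          have h2 := congrArg (fun x : ℝ => (x : ℂ)) this
          simp only [← intervalIntegral.integral_ofReal] at h2
          push_cast at h2
          rw [h2]
          field_simp
          simp
        rw [← integral_Ioc_eq_integral_Ioo, ← intervalIntegral.integral_of_le h'.le, hi]
        simp [cesaroKernel, hw, h', sub_eq_add_neg]
      · simp [cesaroKernel, h'.not_gt]
    · simp [cesaroKernel, hw]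
  rw [h, hausdorffOp_const_mul (cesaroKernel_spec.add (hk.const_mul (-1))),
    hausdorffOp_add cesaroKernel_spec (hk.const_mul (-1)), hausdorffOp_const_mul hk, smul_smul,
    mul_inv_cancel₀ hn, one_smul, neg_one_smul, ← sub_eq_add_neg]
  rfl

theorem re_nonneg_of_norm_sub_one {z : ℂ} (hz : ‖z - 1‖ = 1) : 0 ≤ z.re := by
  have h := (neg_le_abs _).trans (Complex.abs_re_le_norm (z - 1))
  rw [hz] at h
  simp at h
  linarith

theorem one_add_mul_ne_zero {z : ℂ} (hz : ‖z - 1‖ = 1) (n : ℕ) : 1 + (n : ℂ) * z ≠ 0 := by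
  intro h
  have h2 := congrArg Complex.re h
  have h3 := re_nonneg_of_norm_sub_one hz
  simp at h2
  have : (0 : ℝ) ≤ n * z.re := by positivity
  linarith

theorem continuousOn_div_one_add_mul (n : ℕ) :
    ContinuousOn (fun z : ℂ => z / (1 + (n : ℂ) * z)) (spectrum ℂ cesaroOp) := by
  refine ContinuousOn.div (by fun_prop) (by fun_prop) fun z hz => ?_
  exact one_add_mul_ne_zero (norm_sub_one_of_mem_spectrum_cesaroOp hz) n

/-- The convolution identity reads P(1 + n𝒞) = 𝒞. As Re z ≥ 0 on the spectrum, 1 + nz has no zero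
there, and 1 + n𝒞 can be inverted inside the functional calculus. -/
theorem powOp_eq_cfc (n : ℕ) : powOp n = cfc (fun z : ℂ => z / (1 + (n : ℂ) * z)) cesaroOp := by
  cases n with
  | zero =>
    simp only [Nat.cast_zero, zero_mul, add_zero, div_one]
    rw [cfc_id' ℂ cesaroOp]
    refine hausdorffOp_congr _ _ (Filter.Eventually.of_forall fun u => ?_)
    simp [cesaroKernel]
  | succ n =>
    have h1 : powOp (n + 1) * (1 + ((n : ℂ) + 1) • cesaroOp) = cesaroOp := by
      rw [mul_add, mul_one, mul_smul_comm, powOp_succ_mul_cesaroOp]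
      abel
    have hc1 : ContinuousOn (fun z : ℂ => 1 + ((n + 1 : ℕ) : ℂ) * z) (spectrum ℂ cesaroOp) := by
      fun_prop
    have hc2 : ContinuousOn (fun z : ℂ => (1 + ((n + 1 : ℕ) : ℂ) * z)⁻¹) (spectrum ℂ cesaroOp) :=
      hc1.inv₀ fun z hz => one_add_mul_ne_zero (norm_sub_one_of_mem_spectrum_cesaroOp hz) _
    have h2 : 1 + ((n : ℂ) + 1) • cesaroOp =
        cfc (fun z : ℂ => 1 + ((n + 1 : ℕ) : ℂ) * z) cesaroOp := by
      rw [cfc_const_add (1 : ℂ) (fun z => ((n + 1 : ℕ) : ℂ) * z) cesaroOp,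
        cfc_const_mul_id ((n + 1 : ℕ) : ℂ) cesaroOp]
      simp
    have h3 : (1 + ((n : ℂ) + 1) • cesaroOp) *
        cfc (fun z : ℂ => (1 + ((n + 1 : ℕ) : ℂ) * z)⁻¹) cesaroOp = 1 := by
      rw [h2, ← cfc_mul _ _ cesaroOp hc1 hc2, ← cfc_one ℂ cesaroOp]
      refine cfc_congr fun z hz => ?_
      exact mul_inv_cancel₀ (one_add_mul_ne_zero (norm_sub_one_of_mem_spectrum_cesaroOp hz) _)
    calc powOp (n + 1) = powOp (n + 1) * ((1 + ((n : ℂ) + 1) • cesaroOp) *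
          cfc (fun z : ℂ => (1 + ((n + 1 : ℕ) : ℂ) * z)⁻¹) cesaroOp) := by rw [h3, mul_one]
      _ = cfc (fun z : ℂ => z) cesaroOp *
          cfc (fun z : ℂ => (1 + ((n + 1 : ℕ) : ℂ) * z)⁻¹) cesaroOp := by
        rw [← mul_assoc, h1, cfc_id' ℂ cesaroOp]
      _ = _ := by
        rw [← cfc_mul _ _ cesaroOp (by fun_prop) hc2]
        simp only [div_eq_mul_inv]

/-! ### Symbols of Hausdorff operators -/

/-- The symbol `z ↦ ∫ K(u) u^{1/z-1} du` of a Hausdorff operator, as a function of the spectral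
variable of the Cesàro operator. -/
def hausdorffSymbol (K : ℝ → ℂ) (z : ℂ) : ℂ :=
  if z = 0 then 0 else ∫ u in Ioo (0 : ℝ) 1, K u * (u : ℂ) ^ (z⁻¹ - 1)

theorem norm_cpow_inv_sub_one {z : ℂ} (hz : ‖z - 1‖ = 1) (h0 : z ≠ 0) {u : ℝ} (hu : 0 < u) :
    ‖(u : ℂ) ^ (z⁻¹ - 1)‖ = |u| ^ (-(1 / 2) : ℝ) := by
  rw [Complex.norm_cpow_eq_rpow_re_of_pos hu, Complex.sub_re, re_inv_of_norm_sub_one hz h0,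
    abs_of_pos hu]
  norm_num

theorem integrableOn_hausdorffSymbol {K : ℝ → ℂ} (hK : HausdorffKernel K) {z : ℂ}
    (hz : ‖z - 1‖ = 1) (h0 : z ≠ 0) :
    IntegrableOn (fun u : ℝ => K u * (u : ℂ) ^ (z⁻¹ - 1)) (Ioo 0 1) volume := by
  refine Integrable.mono (Integrable.integrableOn hK) ?_ ?_
  · exact (hK.aestronglyMeasurable.mul
      (Measurable.aestronglyMeasurable (by fun_prop))).restrict
  · filter_upwards [ae_restrict_mem measurableSet_Ioo] with u hu
    rw [norm_mul, norm_mul, norm_cpow_inv_sub_one hz h0 hu.1, Complex.norm_real,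
      Real.norm_of_nonneg (Real.rpow_nonneg (abs_nonneg u) _)]

theorem hausdorffSymbol_add {K L : ℝ → ℂ} (hK : HausdorffKernel K) (hL : HausdorffKernel L) {z : ℂ}
    (hz : ‖z - 1‖ = 1) :
    hausdorffSymbol (fun u => K u + L u) z = hausdorffSymbol K z + hausdorffSymbol L z := by
  by_cases h0 : z = 0
  · simp [hausdorffSymbol, h0]
  · simp only [hausdorffSymbol, if_neg h0, add_mul]
    exact integral_add (integrableOn_hausdorffSymbol hK hz h0) (integrableOn_hausdorffSymbol hL hz h0)

theorem hausdorffSymbol_const_mul (K : ℝ → ℂ) (c z : ℂ) :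
    hausdorffSymbol (fun u => c * K u) z = c * hausdorffSymbol K z := by
  by_cases h0 : z = 0
  · simp [hausdorffSymbol, h0]
  · simp only [hausdorffSymbol, if_neg h0, mul_assoc]
    exact integral_const_mul _ _

/-- On the circle Re(1/z) = 1/2, so |u^(1/z-1)| is exactly the weight |u|^(-1/2). The bound is the
same as for the operator in `norm_hausdorffOp_le`. -/
theorem norm_hausdorffSymbol_le {K : ℝ → ℂ} (hK : HausdorffKernel K) {z : ℂ} (hz : ‖z - 1‖ = 1) :
    ‖hausdorffSymbol K z‖ ≤ ∫ u : ℝ, ‖K u‖ * |u| ^ (-(1 / 2) : ℝ) := by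
  have hnn : ∀ u : ℝ, 0 ≤ ‖K u‖ * |u| ^ (-(1 / 2) : ℝ) := fun u => by positivity
  by_cases h0 : z = 0
  · simp only [hausdorffSymbol, if_pos h0, norm_zero]
    exact integral_nonneg hnn
  · simp only [hausdorffSymbol, if_neg h0]
    refine (norm_integral_le_integral_norm _).trans ?_
    have e : ∫ u in Ioo (0 : ℝ) 1, ‖K u * (u : ℂ) ^ (z⁻¹ - 1)‖ =
        ∫ u in Ioo (0 : ℝ) 1, ‖K u‖ * |u| ^ (-(1 / 2) : ℝ) := by
      refine setIntegral_congr_fun measurableSet_Ioo fun u hu => ?_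
      simp only [norm_mul, norm_cpow_inv_sub_one hz h0 hu.1]
    rw [e]
    refine setIntegral_le_integral ?_ (Filter.Eventually.of_forall hnn)
    refine (Integrable.norm hK).congr (Filter.Eventually.of_forall fun u => ?_)
    simp only [norm_mul, Complex.norm_real, Real.norm_of_nonneg (Real.rpow_nonneg (abs_nonneg u) _)]

/-- The integral of u^(n+1/z-1) over (0,1) is 1/(n + 1/z). The convention that symbols vanish at 0
fits the right-hand side. -/
theorem hausdorffSymbol_pow (n : ℕ) {z : ℂ} (hz : ‖z - 1‖ = 1) :
    hausdorffSymbol ((Ioo (0 : ℝ) 1).indicator fun u : ℝ => (u : ℂ) ^ n) z =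
      z / (1 + (n : ℂ) * z) := by
  by_cases h0 : z = 0
  · simp [hausdorffSymbol, h0]
  · simp only [hausdorffSymbol, if_neg h0]
    have hre := re_inv_of_norm_sub_one hz h0
    have e : ∫ u in Ioo (0 : ℝ) 1, (Ioo (0 : ℝ) 1).indicator (fun u : ℝ => (u : ℂ) ^ n) u *
        (u : ℂ) ^ (z⁻¹ - 1) = ∫ u in Ioo (0 : ℝ) 1, (u : ℂ) ^ ((n : ℂ) + z⁻¹ - 1) := by
      refine setIntegral_congr_fun measurableSet_Ioo fun u hu => ?_
      have hu0 : (u : ℂ) ≠ 0 := by exact_mod_cast hu.1.ne'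
      simp only [indicator_of_mem hu]
      rw [add_sub_assoc, Complex.cpow_add _ _ hu0, Complex.cpow_natCast]
    have hn : (0 : ℝ) ≤ n := n.cast_nonneg
    have hre2 : 0 < ((n : ℂ) + z⁻¹).re := by
      rw [Complex.add_re, hre, Complex.natCast_re]
      linarith
    have hne : (n : ℂ) + z⁻¹ ≠ 0 := fun h => by simp [h] at hre2
    rw [e, ← integral_Ioc_eq_integral_Ioo, ← intervalIntegral.integral_of_le zero_le_one,
      integral_cpow (Or.inl (by simpa using hre2)), sub_add_cancel, Complex.ofReal_one,
      Complex.one_cpow, Complex.ofReal_zero, Complex.zero_cpow hne, sub_zero]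
    have := one_add_mul_ne_zero hz n
    rw [div_eq_div_iff hne this]
    field_simp
    ring

/-- F is built as a sum of the functions a z/(1 + nz), so its continuity needs no analysis of the
integral defining the symbol. -/
theorem hausdorffOp_polynomial (q : Polynomial ℂ) :
    ∃ F : ℂ → ℂ, ContinuousOn F (spectrum ℂ cesaroOp) ∧
      hausdorffOp _ (hausdorffKernel_indicator (g := fun u : ℝ => q.eval (u : ℂ)) (by fun_prop)) =
        cfc F cesaroOp ∧
      ∀ z ∈ spectrum ℂ cesaroOp,
        F z = hausdorffSymbol ((Ioo (0 : ℝ) 1).indicator fun u : ℝ => q.eval (u : ℂ)) z := by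
  induction q using Polynomial.induction_on' with
  | add p q hp hq =>
    obtain ⟨F, hF, hF1, hF2⟩ := hp
    obtain ⟨G, hG, hG1, hG2⟩ := hq
    have e : ((Ioo (0 : ℝ) 1).indicator fun u : ℝ => (p + q).eval (u : ℂ)) =
        fun u => (Ioo (0 : ℝ) 1).indicator (fun u : ℝ => p.eval (u : ℂ)) u +
          (Ioo (0 : ℝ) 1).indicator (fun u : ℝ => q.eval (u : ℂ)) u := by
      funext u
      by_cases hu : u ∈ Ioo (0 : ℝ) 1 <;> simp [hu]
    refine ⟨fun z => F z + G z, hF.add hG, ?_, fun z hz => ?_⟩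
    · rw [cfc_add _ _ _ hF hG, ← hF1, ← hG1, ← hausdorffOp_add]
      exact hausdorffOp_congr _ _ (Filter.Eventually.of_forall fun u => congrFun e u)
    · rw [e, hausdorffSymbol_add (hausdorffKernel_indicator (by fun_prop))
        (hausdorffKernel_indicator (by fun_prop)) (norm_sub_one_of_mem_spectrum_cesaroOp hz),
        ← hF2 z hz, ← hG2 z hz]
  | monomial n a =>
    have e : ((Ioo (0 : ℝ) 1).indicator fun u : ℝ => (Polynomial.monomial n a).eval (u : ℂ)) =
        fun u => a * (Ioo (0 : ℝ) 1).indicator (fun u : ℝ => (u : ℂ) ^ n) u := by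
      funext u
      by_cases hu : u ∈ Ioo (0 : ℝ) 1 <;> simp [hu]
    refine ⟨fun z => a * (z / (1 + (n : ℂ) * z)),
      continuousOn_const.mul (continuousOn_div_one_add_mul n), ?_, fun z hz => ?_⟩
    · rw [cfc_const_mul _ _ _ (continuousOn_div_one_add_mul n), ← powOp_eq_cfc, powOp,
        ← hausdorffOp_const_mul]
      exact hausdorffOp_congr _ _ (Filter.Eventually.of_forall fun u => congrFun e u)
    · rw [e, hausdorffSymbol_const_mul,
        hausdorffSymbol_pow n (norm_sub_one_of_mem_spectrum_cesaroOp hz)]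

/-! ### The Gamma integral with a complex rate -/

theorem integrableOn_cpow_mul_exp_neg_mul {a p : ℂ} (ha : 0 < a.re) (hp : 0 < p.re) :
    IntegrableOn (fun t : ℝ => (t : ℂ) ^ (a - 1) * Complex.exp (-p * t)) (Ioi 0) volume := by
  have hr := integrableOn_rpow_mul_exp_neg_mul_rpow (p := 1) (s := a.re - 1) (b := p.re)
    (by linarith) one_pos hp
  refine Integrable.mono' hr (Measurable.aestronglyMeasurable (by fun_prop)) ?_
  filter_upwards [ae_restrict_mem measurableSet_Ioi] with t ht
  rw [norm_mul, Complex.norm_cpow_eq_rpow_re_of_pos ht, Complex.norm_exp]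
  simp

/-- Differentiation under the integral sign: on the ball of radius Re p / 2 about p real parts stay
above Re p / 2, which gives the dominating function t^(Re a) e^(-t Re p / 2). -/
theorem differentiableOn_integral_cpow_mul_exp {a : ℂ} (ha : 0 < a.re) :
    DifferentiableOn ℂ (fun p : ℂ => ∫ t : ℝ in Ioi 0, (t : ℂ) ^ (a - 1) * Complex.exp (-p * t))
      {p : ℂ | 0 < p.re} := by
  intro p hp
  have hp' : 0 < p.re := hp
  have h2 : 0 < p.re / 2 := by linarith
  have hball : ∀ x ∈ Metric.ball p (p.re / 2), p.re / 2 ≤ x.re := by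
    intro x hx
    rw [Metric.mem_ball, dist_eq_norm] at hx
    have h := (abs_le.mp ((Complex.abs_re_le_norm (x - p)).trans hx.le)).1
    rw [Complex.sub_re] at h
    linarith
  refine (hasDerivAt_integral_of_dominated_loc_of_deriv_le
    (μ := volume.restrict (Ioi (0 : ℝ)))
    (F := fun (x : ℂ) (t : ℝ) => (t : ℂ) ^ (a - 1) * Complex.exp (-x * t))
    (F' := fun x t => (t : ℂ) ^ (a - 1) * (Complex.exp (-x * t) * (-t)))
    (bound := fun t : ℝ => t ^ (a.re) * Real.exp (-(p.re / 2) * t ^ (1 : ℝ)))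
    (Metric.ball_mem_nhds p h2)
    (Filter.Eventually.of_forall fun x => Measurable.aestronglyMeasurable (by fun_prop))
    (integrableOn_cpow_mul_exp_neg_mul ha hp')
    (Measurable.aestronglyMeasurable (by fun_prop)) ?_
    (integrableOn_rpow_mul_exp_neg_mul_rpow (by linarith) one_pos h2)
    ?_).2.differentiableAt.differentiableWithinAt
  · filter_upwards [ae_restrict_mem measurableSet_Ioi] with t ht x hx
    have ht0 : (0 : ℝ) < t := ht
    rw [norm_mul, norm_mul, Complex.norm_cpow_eq_rpow_re_of_pos ht, Complex.norm_exp, norm_neg,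
      Complex.norm_real, Real.norm_of_nonneg ht0.le, Real.rpow_one]
    have e : t ^ (a.re) = t ^ (a - 1).re * t := by
      rw [← Real.rpow_add_one ht0.ne']
      simp
    rw [e, mul_assoc, mul_comm t]
    have hx' := mul_le_mul_of_nonneg_right (hball x hx) ht0.le
    gcongr
    simp
    linarith
  · refine Filter.Eventually.of_forall fun t x _ => ?_
    have h : HasDerivAt (fun x : ℂ => -x * (t : ℂ)) (-(t : ℂ)) x := by
      simpa using (hasDerivAt_id x).neg.mul_const (t : ℂ)
    exact h.cexp.const_mul _

/-- Identity theorem: both sides are holomorphic on the right half-plane and agree for real p, in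
particular at the points 1 + 1/(n+1), which accumulate at 1. -/
theorem integral_cpow_mul_cexp_neg_mul_Ioi {a p : ℂ} (ha : 0 < a.re) (hp : 0 < p.re) :
    ∫ t : ℝ in Ioi 0, (t : ℂ) ^ (a - 1) * Complex.exp (-p * t) = (p⁻¹) ^ a * Complex.Gamma a := by
  have hopen : IsOpen {p : ℂ | 0 < p.re} := isOpen_lt continuous_const Complex.continuous_re
  have hconv : Convex ℝ {p : ℂ | 0 < p.re} := convex_halfSpace_re_gt 0
  have hf := (differentiableOn_integral_cpow_mul_exp ha).analyticOnNhd hopen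
  have hg : AnalyticOnNhd ℂ (fun p : ℂ => (p⁻¹) ^ a * Complex.Gamma a) {p : ℂ | 0 < p.re} := by
    refine DifferentiableOn.analyticOnNhd (fun x hx => ?_) hopen
    have hx' : 0 < x.re := hx
    have hx0 : x ≠ 0 := fun h => by simp [h] at hx'
    have hi : x⁻¹ ∈ Complex.slitPlane := by
      left
      rw [Complex.inv_re]
      exact div_pos hx' (Complex.normSq_pos.mpr hx0)
    exact (((differentiableAt_inv hx0).cpow_const hi).mul_const _).differentiableWithinAt
  refine hf.eqOn_of_preconnected_of_frequently_eq hg hconv.isPreconnected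
    (z₀ := 1) (by simp) ?_ hp
  have hlim : Filter.Tendsto (fun n : ℕ => ((1 + (n + 1 : ℝ)⁻¹ : ℝ) : ℂ)) Filter.atTop
      (nhdsWithin 1 {1}ᶜ) := by
    refine tendsto_nhdsWithin_iff.mpr ⟨?_, Filter.Eventually.of_forall fun n => ?_⟩
    · have h := (tendsto_one_div_add_atTop_nhds_zero_nat (𝕜 := ℝ)).const_add 1
      simp only [one_div, add_zero] at h
      have h2 := (Complex.continuous_ofReal.tendsto 1).comp h
      rw [Complex.ofReal_one] at h2
      exact h2
    · rw [mem_compl_iff, mem_singleton_iff]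
      norm_cast
      have : (0 : ℝ) < (n + 1 : ℝ)⁻¹ := by positivity
      push_cast
      linarith
  refine hlim.frequently (Filter.Frequently.of_forall fun n => ?_)
  have hr : (0 : ℝ) < 1 + (n + 1 : ℝ)⁻¹ := by positivity
  have h := Complex.integral_cpow_mul_exp_neg_mul_Ioi ha hr
  rw [one_div] at h
  rw [← h]
  simp only [neg_mul]

/-! ### From polynomial kernels to all kernels on (0,1) -/

/-- Polynomials are dense in `L¹((0,1), |u|^{-1/2} du)`. -/
theorem exists_polynomial_integral_sub_le {k : ℝ → ℂ}
    (hK : HausdorffKernel ((Ioo (0 : ℝ) 1).indicator k)) {ε : ℝ} (hε : 0 < ε) :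
    ∃ q : Polynomial ℂ, ∫ u : ℝ, ‖(Ioo (0 : ℝ) 1).indicator k u +
      -1 * (Ioo (0 : ℝ) 1).indicator (fun u : ℝ => q.eval (u : ℂ)) u‖ * |u| ^ (-(1 / 2) : ℝ) ≤ ε := by
  set K := (Ioo (0 : ℝ) 1).indicator k with hKdef
  set w : ℝ → ℝ≥0∞ := fun u => ENNReal.ofReal (|u| ^ (-(1 / 2) : ℝ)) with hw
  have hwm : Measurable w := by fun_prop
  have hwt : ∀ u, (w u).toReal = |u| ^ (-(1 / 2) : ℝ) := fun u =>
    ENNReal.toReal_ofReal (by positivity)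
  -- The weighted norm is the L¹ norm of this finite measure, so K is approximated first by a
  -- bounded continuous function and then, by Weierstrass, by a polynomial.
  set μ : Measure ℝ := (volume.restrict (Ioo (0 : ℝ) 1)).withDensity w with hμ
  have hwint : IntegrableOn (fun u : ℝ => |u| ^ (-(1 / 2) : ℝ)) (Ioo 0 1) volume := by
    have h := (integrableOn_abs_rpow_neg_half.mono_set Ioo_subset_Icc_self).re
    simpa [IntegrableOn] using h
  have : IsFiniteMeasure μ := isFiniteMeasure_withDensity_ofReal hwint.2
  have hlt : ∀ᵐ u ∂(volume.restrict (Ioo (0 : ℝ) 1)), w u < ∞ :=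
    Filter.Eventually.of_forall fun u => ENNReal.ofReal_lt_top
  have hKμ : Integrable K μ := by
    rw [hμ, integrable_withDensity_iff_integrable_smul' hwm hlt]
    refine (Integrable.integrableOn hK).congr (Filter.Eventually.of_forall fun u => ?_)
    simp only [hwt, Complex.real_smul]
    ring
  have hintμ : ∀ g : ℝ → ℝ, ∫ u, g u ∂μ = ∫ u in Ioo (0 : ℝ) 1, g u * |u| ^ (-(1 / 2) : ℝ) := by
    intro g
    rw [hμ, integral_withDensity_eq_integral_toReal_smul hwm hlt]
    simp only [hwt, smul_eq_mul, mul_comm]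
  have hμ01 : ∀ᵐ u ∂μ, u ∈ Ioo (0 : ℝ) 1 :=
    (withDensity_absolutelyContinuous _ _).ae_le (ae_restrict_mem measurableSet_Ioo)
  obtain ⟨g, hg, hgi⟩ := hKμ.exists_boundedContinuous_integral_sub_le (half_pos hε)
  set m : ℝ := μ.real univ with hm
  have hm0 : 0 ≤ m := measureReal_nonneg
  -- Real and imaginary parts each cost η, so the uniform error is 2η and its μ-integral at most 2mη
  -- ≤ ε/2; m + 1 avoids dividing by zero.
  set η : ℝ := ε / (4 * (m + 1)) with hη
  have hηpos : 0 < η := by positivity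
  obtain ⟨p₁, hp₁⟩ := exists_polynomial_near_of_continuousOn 0 1 (fun x => (g x).re)
    (Complex.continuous_re.comp g.continuous).continuousOn η hηpos
  obtain ⟨p₂, hp₂⟩ := exists_polynomial_near_of_continuousOn 0 1 (fun x => (g x).im)
    (Complex.continuous_im.comp g.continuous).continuousOn η hηpos
  set q : Polynomial ℂ := p₁.map Complex.ofRealHom + Polynomial.C Complex.I *
    p₂.map Complex.ofRealHom with hq
  have hqe : ∀ u : ℝ, q.eval (u : ℂ) = ((p₁.eval u : ℝ) : ℂ) + Complex.I * ((p₂.eval u : ℝ) : ℂ) := by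
    intro u
    have e : ∀ p : Polynomial ℝ, (p.map Complex.ofRealHom).eval (u : ℂ) = ((p.eval u : ℝ) : ℂ) :=
      fun p => Polynomial.eval_map_apply (f := Complex.ofRealHom) u
    rw [hq, Polynomial.eval_add, Polynomial.eval_mul, Polynomial.eval_C, e, e]
  have hgq : ∀ u ∈ Ioo (0 : ℝ) 1, ‖g u - q.eval (u : ℂ)‖ ≤ 2 * η := by
    intro u hu
    have h1 := hp₁ u (Ioo_subset_Icc_self hu)
    have h2 := hp₂ u (Ioo_subset_Icc_self hu)
    refine (Complex.norm_le_abs_re_add_abs_im _).trans ?_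
    rw [hqe]
    simp only [Complex.sub_re, Complex.add_re, Complex.ofReal_re, Complex.mul_re, Complex.I_re,
      Complex.I_im, Complex.ofReal_im, Complex.sub_im, Complex.add_im, Complex.mul_im, zero_mul,
      one_mul, mul_zero, sub_zero, add_zero, zero_add]
    rw [abs_sub_comm, abs_sub_comm (g u).im]
    linarith
  have hqμ : Integrable (fun u : ℝ => g u - q.eval (u : ℂ)) μ :=
    Integrable.of_bound (C := 2 * η)
      (by fun_prop : Continuous fun u : ℝ => g u - q.eval (u : ℂ)).aestronglyMeasurable
      (hμ01.mono hgq)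
  refine ⟨q, ?_⟩
  have e : (fun u : ℝ => ‖K u + -1 * (Ioo (0 : ℝ) 1).indicator (fun u : ℝ => q.eval (u : ℂ)) u‖ *
      |u| ^ (-(1 / 2) : ℝ)) =
      (Ioo (0 : ℝ) 1).indicator fun u => ‖K u - q.eval (u : ℂ)‖ * |u| ^ (-(1 / 2) : ℝ) := by
    funext u
    by_cases hu : u ∈ Ioo (0 : ℝ) 1 <;> simp [hu, hKdef, sub_eq_add_neg]
  rw [e, integral_indicator measurableSet_Ioo, ← hintμ]
  calc ∫ u, ‖K u - q.eval (u : ℂ)‖ ∂μ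
      ≤ ∫ u, (‖K u - g u‖ + ‖g u - q.eval (u : ℂ)‖) ∂μ := by
        refine integral_mono_of_nonneg (Filter.Eventually.of_forall fun u => norm_nonneg _)
          ((hKμ.sub hgi).norm.add hqμ.norm) (Filter.Eventually.of_forall fun u => ?_)
        exact norm_sub_le_norm_sub_add_norm_sub _ _ _
    _ = ∫ u, ‖K u - g u‖ ∂μ + ∫ u, ‖g u - q.eval (u : ℂ)‖ ∂μ :=
        integral_add (hKμ.sub hgi).norm hqμ.norm
    _ ≤ ε / 2 + m * (2 * η) := by
        refine add_le_add hg ?_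
        refine (integral_mono_ae hqμ.norm (integrable_const (2 * η)) (hμ01.mono hgq)).trans ?_
        rw [integral_const, smul_eq_mul]
    _ ≤ ε := by
        have : m * (2 * η) ≤ ε / 2 := by
          rw [hη, ← mul_div_assoc, ← mul_div_assoc, div_le_div_iff₀ (by positivity) two_pos]
          nlinarith
        linarith

/-- A Hausdorff operator with kernel supported in `(0, 1)` is obtained from the Cesàro operator by
applying its symbol. -/
theorem hausdorffOp_eq_cfc {k : ℝ → ℂ} (hK : HausdorffKernel ((Ioo (0 : ℝ) 1).indicator k))
    {F : ℂ → ℂ} (hF : ContinuousOn F (spectrum ℂ cesaroOp))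
    (h : ∀ z ∈ spectrum ℂ cesaroOp, F z = hausdorffSymbol ((Ioo (0 : ℝ) 1).indicator k) z) :
    hausdorffOp _ hK = cfc F cesaroOp := by
  refine eq_of_forall_dist_le fun ε hε => ?_
  -- Replacing K by q costs at most ε/2 in the operator and, by the bound on symbols, at most ε/2 in
  -- the functional calculus.
  obtain ⟨q, hq⟩ := exists_polynomial_integral_sub_le hK (half_pos hε)
  obtain ⟨G, hG, hG1, hG2⟩ := hausdorffOp_polynomial q
  have hQ : HausdorffKernel ((Ioo (0 : ℝ) 1).indicator fun u : ℝ => q.eval (u : ℂ)) :=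
    hausdorffKernel_indicator (by fun_prop)
  have hD := hK.add (hQ.const_mul (-1))
  have h1 : ‖hausdorffOp _ hK - hausdorffOp _ hQ‖ ≤ ε / 2 := by
    have e : hausdorffOp _ hK - hausdorffOp _ hQ = hausdorffOp _ hD := by
      rw [hausdorffOp_add hK (hQ.const_mul (-1)), hausdorffOp_const_mul hQ, neg_one_smul,
        sub_eq_add_neg]
    rw [e]
    exact (norm_hausdorffOp_le hD).trans hq
  have h2 : ‖cfc G cesaroOp - cfc F cesaroOp‖ ≤ ε / 2 := by
    rw [norm_sub_rev, ← cfc_sub _ _ cesaroOp hF hG]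
    refine norm_cfc_le (half_pos hε).le fun z hz => ?_
    have hz1 := norm_sub_one_of_mem_spectrum_cesaroOp hz
    have e : F z - G z = hausdorffSymbol (fun u => (Ioo (0 : ℝ) 1).indicator k u +
        -1 * (Ioo (0 : ℝ) 1).indicator (fun u : ℝ => q.eval (u : ℂ)) u) z := by
      rw [hausdorffSymbol_add hK (hQ.const_mul (-1)) hz1, hausdorffSymbol_const_mul, h z hz,
        hG2 z hz]
      ring
    rw [e]
    exact (norm_hausdorffSymbol_le hD hz1).trans hq
  rw [dist_eq_norm, ← sub_add_sub_cancel _ (hausdorffOp _ hQ)]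
  refine (norm_add_le _ _).trans ?_
  have h3 : ‖hausdorffOp _ hQ - cfc F cesaroOp‖ ≤ ε / 2 := by
    rw [hG1]
    exact h2
  linarith

/-! ### The Hölder mean as a power of 𝒞 -/

/-- For z ≠ 0 the substitution u = e^(-t) gives the Gamma integral with rate p = 1/z, of real part
1/2. Its value is Γ(α) z^α, and the normalisation of the kernel removes Γ(α). -/
theorem hausdorffSymbol_holderKernel {α : ℂ} (hα : 0 < α.re) {z : ℂ} (hz : ‖z - 1‖ = 1) :
    hausdorffSymbol (holderKernel α) z = z ^ α := by
  have hα0 : α ≠ 0 := fun h => by simp [h] at hα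
  by_cases h0 : z = 0
  · simp [hausdorffSymbol, h0, Complex.zero_cpow hα0]
  simp only [hausdorffSymbol, if_neg h0]
  have himg : (fun t : ℝ => Real.exp (-t)) '' Ioi 0 = Ioo 0 1 := by
    ext u
    constructor
    · rintro ⟨t, ht, rfl⟩
      exact ⟨Real.exp_pos _, by simpa using ht⟩
    · rintro ⟨h0, h1⟩
      exact ⟨-Real.log u, by simpa using Real.log_neg h0 h1, by simp [Real.exp_log h0]⟩
  have hd : ∀ t ∈ Ioi (0 : ℝ), HasDerivWithinAt (fun t : ℝ => Real.exp (-t))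
      (-Real.exp (-t)) (Ioi 0) t := by
    intro t _
    have h := ((hasDerivAt_id t).neg.exp).hasDerivWithinAt (s := Ioi 0)
    simpa using h
  have hinj : InjOn (fun t : ℝ => Real.exp (-t)) (Ioi 0) := by
    intro s _ t _ hst
    simpa using hst
  rw [← himg, integral_image_eq_integral_abs_deriv_smul measurableSet_Ioi hd hinj]
  have hpre : 0 < (z⁻¹).re := by rw [re_inv_of_norm_sub_one hz h0]; norm_num
  have hΓ := integral_cpow_mul_cexp_neg_mul_Ioi hα hpre
  have e : ∀ t ∈ Ioi (0 : ℝ), |-Real.exp (-t)| • (holderKernel α (Real.exp (-t)) *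
      ((Real.exp (-t) : ℝ) : ℂ) ^ (z⁻¹ - 1)) =
      (Complex.Gamma α)⁻¹ * ((t : ℂ) ^ (α - 1) * Complex.exp (-z⁻¹ * t)) := by
    intro t ht
    have hm : Real.exp (-t) ∈ Ioo (0 : ℝ) 1 := himg ▸ mem_image_of_mem _ ht
    have hne : ((Real.exp (-t) : ℝ) : ℂ) ≠ 0 := by exact_mod_cast (Real.exp_pos _).ne'
    rw [holderKernel, indicator_of_mem hm, Real.log_inv, Real.log_exp, neg_neg, abs_neg,
      abs_of_pos (Real.exp_pos _), Complex.real_smul, Complex.cpow_sub _ _ hne, Complex.cpow_one]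
    have e2 : ((Real.exp (-t) : ℝ) : ℂ) ^ z⁻¹ = Complex.exp (-z⁻¹ * t) := by
      rw [Complex.cpow_def_of_ne_zero hne, ← Complex.ofReal_log (Real.exp_pos _).le, Real.log_exp]
      congr 1
      push_cast
      ring
    rw [e2]
    field_simp
  rw [setIntegral_congr_fun measurableSet_Ioi e, integral_const_mul, hΓ]
  have hΓ0 := Complex.Gamma_ne_zero_of_re_pos hα
  rw [inv_inv]
  field_simp

theorem continuousOn_cpow_spectrum_cesaroOp {α : ℂ} (hα : 0 < α.re) :
    ContinuousOn (fun z : ℂ => z ^ α) (spectrum ℂ cesaroOp) :=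
  fun _ hz => (Complex.continuousAt_cpow_const_of_re_pos (Or.inl (re_nonneg_of_norm_sub_one
    (norm_sub_one_of_mem_spectrum_cesaroOp hz))) hα).continuousWithinAt

/-- The Hölder mean of order `α` is the fractional power `𝒞^α`. -/
theorem holderOp_eq_cesaroPow {α : ℂ} (hα : 0 < α.re) : holderOp α hα = cesaroPow α :=
  hausdorffOp_eq_cfc _ (continuousOn_cpow_spectrum_cesaroOp hα) fun _ hz =>
    (hausdorffSymbol_holderKernel hα (norm_sub_one_of_mem_spectrum_cesaroOp hz)).symm

theorem spectrum_cesaroPow {α : ℂ} (hα : 0 < α.re) :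
    spectrum ℂ (cesaroPow α) = (fun z : ℂ => z ^ α) '' {z : ℂ | ‖z - 1‖ = 1} := by
  rw [cesaroPow, cfc_map_spectrum (R := ℂ) (fun z : ℂ => z ^ α) cesaroOp isStarNormal_cesaroOp
    (continuousOn_cpow_spectrum_cesaroOp hα), spectrum_cesaroOp]

/-! ### Powers along the circle in polar form -/

/-- The circle `𝕋 + 1` in polar coordinates, and the power function along it. -/
theorem exists_polar_of_norm_sub_one {z : ℂ} (hz : ‖z - 1‖ = 1) :
    ∃ t ∈ Icc (-(Real.pi / 2)) (Real.pi / 2),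
      z = (2 * Real.cos t : ℝ) * Complex.exp (t * Complex.I) := by
  by_cases h0 : z = 0
  · exact ⟨Real.pi / 2, ⟨by linarith [Real.pi_pos], le_rfl⟩, by simp [h0]⟩
  have hre := re_nonneg_of_norm_sub_one hz
  refine ⟨z.arg, abs_le.mp (Complex.abs_arg_le_pi_div_two_iff.mpr hre), ?_⟩
  have hn : ‖z‖ ≠ 0 := norm_ne_zero_iff.mpr h0
  -- On the circle |z|² = 2 Re z = 2|z| cos(arg z).
  have e : 2 * Real.cos z.arg = ‖z‖ := by
    rw [Complex.cos_arg h0]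
    have h := Complex.sq_norm (z - 1)
    have h2 := Complex.sq_norm z
    rw [hz, Complex.normSq_apply] at h
    rw [Complex.normSq_apply] at h2
    simp only [Complex.sub_re, Complex.sub_im, Complex.one_re, Complex.one_im, sub_zero] at h
    field_simp
    linarith
  rw [e, Complex.norm_mul_exp_arg_mul_I]

/-- By Euler's formula 2 cos t · e^(it) = 1 + e^(2it). -/
theorem norm_polar_sub_one (t : ℝ) :
    ‖((2 * Real.cos t : ℝ) : ℂ) * Complex.exp (t * Complex.I) - 1‖ = 1 := by
  have e : ((2 * Real.cos t : ℝ) : ℂ) * Complex.exp (t * Complex.I) - 1 =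
      Complex.exp ((2 * t : ℝ) * Complex.I) := by
    push_cast
    rw [Complex.two_cos, add_mul, ← Complex.exp_add, ← Complex.exp_add, neg_mul, neg_add_cancel,
      Complex.exp_zero, add_sub_cancel_right]
    congr 1
    ring
  rw [e, Complex.norm_exp_ofReal_mul_I]

/-- In the open interval the modulus is positive and t is the principal argument. The endpoints give
z = 0, where the logarithm is of no use and 0^α = 0 is treated apart. -/
theorem polar_cpow {t : ℝ} (ht : t ∈ Ioo (-(Real.pi / 2)) (Real.pi / 2)) (α : ℂ) :
    (((2 * Real.cos t : ℝ) : ℂ) * Complex.exp (t * Complex.I)) ^ α =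
      Complex.exp ((Real.log (2 * Real.cos t) + t * Complex.I) * α) := by
  have hc : 0 < 2 * Real.cos t := mul_pos two_pos (Real.cos_pos_of_mem_Ioo ht)
  have hne : ((2 * Real.cos t : ℝ) : ℂ) * Complex.exp (t * Complex.I) ≠ 0 :=
    mul_ne_zero (by exact_mod_cast hc.ne') (Complex.exp_ne_zero _)
  have hpi := Real.pi_pos
  rw [Complex.cpow_def_of_ne_zero hne, Complex.log_ofReal_mul hc (Complex.exp_ne_zero _),
    Complex.log_exp]
  · simpa using by linarith [ht.1]
  · simpa using by linarith [ht.2]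

theorem mem_Ioo_or_cos_eq_zero {t : ℝ} (ht : t ∈ Icc (-(Real.pi / 2)) (Real.pi / 2)) :
    t ∈ Ioo (-(Real.pi / 2)) (Real.pi / 2) ∨ Real.cos t = 0 := by
  rcases ht.1.eq_or_lt with h | h
  · right
    rw [← h, Real.cos_neg, Real.cos_pi_div_two]
  rcases ht.2.eq_or_lt with h' | h'
  · right
    rw [h', Real.cos_pi_div_two]
  · exact Or.inl ⟨h, h'⟩

theorem norm_polar_cpow {α : ℂ} (hα : 0 < α.re) {t : ℝ}
    (ht : t ∈ Icc (-(Real.pi / 2)) (Real.pi / 2)) :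
    ‖(((2 * Real.cos t : ℝ) : ℂ) * Complex.exp (t * Complex.I)) ^ α‖ =
      (2 * Real.cos t) ^ α.re * Real.exp (-(α.im * t)) := by
  rcases mem_Ioo_or_cos_eq_zero ht with h | h
  · have hc : 0 < 2 * Real.cos t := mul_pos two_pos (Real.cos_pos_of_mem_Ioo h)
    rw [polar_cpow h, Complex.norm_exp, Real.rpow_def_of_pos hc, ← Real.exp_add]
    congr 1
    simp
    ring
  · have hα0 : α ≠ 0 := fun h => by simp [h] at hα
    rw [h, mul_zero, Complex.ofReal_zero, zero_mul, Complex.zero_cpow hα0, norm_zero,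
      Real.zero_rpow hα.ne', zero_mul]

theorem polar_cpow_ofReal {a : ℝ} (ha : 0 < a) {t : ℝ}
    (ht : t ∈ Icc (-(Real.pi / 2)) (Real.pi / 2)) :
    (((2 * Real.cos t : ℝ) : ℂ) * Complex.exp (t * Complex.I)) ^ (a : ℂ) =
      ⟨(2 * Real.cos t) ^ a * Real.cos (a * t), (2 * Real.cos t) ^ a * Real.sin (a * t)⟩ := by
  rcases mem_Ioo_or_cos_eq_zero ht with h | h
  · have hc : 0 < 2 * Real.cos t := mul_pos two_pos (Real.cos_pos_of_mem_Ioo h)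
    rw [polar_cpow h, Real.rpow_def_of_pos hc]
    apply Complex.ext
    · rw [Complex.exp_re]
      simp [mul_comm t a]
    · rw [Complex.exp_im]
      simp [mul_comm t a]
  · have ha0 : (a : ℂ) ≠ 0 := by exact_mod_cast ha.ne'
    rw [h, mul_zero, Complex.ofReal_zero, zero_mul, Complex.zero_cpow ha0, Real.zero_rpow ha.ne',
      zero_mul, zero_mul]
    rfl

/-! ### The norm as a maximum over the circle -/

/-- The function `t ↦ cos t · exp (t tan φ)` is maximal at `φ`. -/
theorem cos_mul_exp_mul_tan_le {φ t : ℝ} (hφ : φ ∈ Ioo (-(Real.pi / 2)) (Real.pi / 2))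
    (ht : t ∈ Icc (-(Real.pi / 2)) (Real.pi / 2)) :
    Real.cos t * Real.exp (t * Real.tan φ) ≤ Real.cos φ * Real.exp (φ * Real.tan φ) := by
  have hc := Real.cos_pos_of_mem_Ioo hφ
  -- In this form the derivative has the sign of sin(φ - s), hence of φ - s, because |φ - s| < π on
  -- the range considered.
  have hd : ∀ s : ℝ, HasDerivAt (fun s => Real.cos s * Real.exp (s * Real.tan φ))
      (Real.exp (s * Real.tan φ) * Real.sin (φ - s) / Real.cos φ) s := by
    intro s
    have h1 : HasDerivAt (fun s : ℝ => s * Real.tan φ) (Real.tan φ) s := by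
      simpa using (hasDerivAt_id s).mul_const (Real.tan φ)
    refine ((Real.hasDerivAt_cos s).mul h1.exp).congr_deriv ?_
    rw [Real.sin_sub, Real.tan_eq_sin_div_cos]
    field_simp
    ring
  have hcont : Continuous fun s => Real.cos s * Real.exp (s * Real.tan φ) := by fun_prop
  rcases le_total t φ with h | h
  · refine monotoneOn_of_deriv_nonneg (convex_Icc t φ) hcont.continuousOn
      (fun s _ => (hd s).differentiableAt.differentiableWithinAt) (fun s hs => ?_)
      (left_mem_Icc.mpr h) (right_mem_Icc.mpr h) h
    rw [interior_Icc] at hs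
    rw [(hd s).deriv]
    have : 0 ≤ Real.sin (φ - s) :=
      Real.sin_nonneg_of_nonneg_of_le_pi (by linarith [hs.2]) (by linarith [hs.1, ht.1, hφ.2])
    positivity
  · refine antitoneOn_of_deriv_nonpos (convex_Icc φ t) hcont.continuousOn
      (fun s _ => (hd s).differentiableAt.differentiableWithinAt) (fun s hs => ?_)
      (left_mem_Icc.mpr h) (right_mem_Icc.mpr h) h
    rw [interior_Icc] at hs
    rw [(hd s).deriv]
    have : Real.sin (φ - s) ≤ 0 :=
      Real.sin_nonpos_of_nonpos_of_neg_pi_le (by linarith [hs.1]) (by linarith [hs.2, ht.2, hφ.1])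
    exact div_nonpos_of_nonpos_of_nonneg
      (mul_nonpos_of_nonneg_of_nonpos (Real.exp_pos _).le this) hc.le

/-- For φ = -arg α one has tan φ = -Im α / Re α, so |z^α| = (2 cos t · e^(t tan φ))^(Re α) at z = 2
cos t · e^(it). The maximum is at t = φ, and that point belongs to the spectrum, so it bounds the
norm from both sides. -/
theorem norm_cesaroPow {α : ℂ} (hα : 0 < α.re) :
    ‖cesaroPow α‖ = (2 * α.re / ‖α‖) ^ α.re * Real.exp (α.im * Complex.arg α) := by
  have hα0 : α ≠ 0 := fun h => by simp [h] at hα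
  set φ := -α.arg with hφdef
  have hφ : φ ∈ Ioo (-(Real.pi / 2)) (Real.pi / 2) := by
    have h := abs_lt.mp (Complex.abs_arg_lt_pi_div_two_iff.mpr (Or.inl hα))
    exact ⟨by linarith [h.2], by linarith [h.1]⟩
  have htan : α.re * Real.tan φ = -α.im := by
    rw [hφdef, Real.tan_neg, Complex.tan_arg]
    field_simp
  have hcos : 2 * Real.cos φ = 2 * α.re / ‖α‖ := by
    rw [hφdef, Real.cos_neg, Complex.cos_arg hα0, mul_div_assoc]
  have hval : (2 * α.re / ‖α‖) ^ α.re * Real.exp (α.im * Complex.arg α) =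
      (2 * Real.cos φ) ^ α.re * Real.exp (-(α.im * φ)) := by
    rw [hcos, hφdef, mul_neg, neg_neg]
  have hpow : ∀ t ∈ Icc (-(Real.pi / 2)) (Real.pi / 2),
      (2 * Real.cos t) ^ α.re * Real.exp (-(α.im * t)) =
        (2 * (Real.cos t * Real.exp (t * Real.tan φ))) ^ α.re := by
    intro t ht
    have hc : 0 ≤ Real.cos t := Real.cos_nonneg_of_mem_Icc ht
    rw [← mul_assoc, Real.mul_rpow (by positivity) (Real.exp_pos _).le, ← Real.exp_mul]
    congr 2
    linear_combination -t * htan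
  rw [hval]
  apply le_antisymm
  · refine norm_cfc_le (mul_nonneg (Real.rpow_nonneg
      (mul_nonneg two_pos.le (Real.cos_pos_of_mem_Ioo hφ).le) _) (Real.exp_pos _).le) fun z hz => ?_
    obtain ⟨t, ht, rfl⟩ :=
      exists_polar_of_norm_sub_one (norm_sub_one_of_mem_spectrum_cesaroOp hz)
    rw [norm_polar_cpow hα ht, hpow t ht, hpow φ (Ioo_subset_Icc_self hφ)]
    have hc : 0 ≤ Real.cos t := Real.cos_nonneg_of_mem_Icc ht
    exact Real.rpow_le_rpow (by positivity)
      (mul_le_mul_of_nonneg_left (cos_mul_exp_mul_tan_le hφ ht) two_pos.le) hα.le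
  · rw [← norm_polar_cpow hα (Ioo_subset_Icc_self hφ)]
    refine norm_apply_le_norm_cfc (fun z : ℂ => z ^ α) cesaroOp ?_
      (continuousOn_cpow_spectrum_cesaroOp hα)
    rw [spectrum_cesaroOp]
    exact norm_polar_sub_one φ

theorem spectrum_cesaroPow_ofReal {a : ℝ} (ha : 0 < a) :
    spectrum ℂ (cesaroPow a) =
      (fun t : ℝ => (⟨(2 * Real.cos t) ^ a * Real.cos (a * t),
        (2 * Real.cos t) ^ a * Real.sin (a * t)⟩ : ℂ)) ''
          Icc (-(Real.pi / 2)) (Real.pi / 2) := by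
  rw [spectrum_cesaroPow (by simpa using ha)]
  ext y
  constructor
  · rintro ⟨z, hz, rfl⟩
    obtain ⟨t, ht, rfl⟩ := exists_polar_of_norm_sub_one hz
    exact ⟨t, ht, (polar_cpow_ofReal ha ht).symm⟩
  · rintro ⟨t, ht, rfl⟩
    exact ⟨_, norm_polar_sub_one t, polar_cpow_ofReal ha ht⟩

end

theorem mainTheorem5 (α : ℂ) (hα : 0 < α.re) :
    spectrum ℂ (holderOp α hα) = spectrum ℂ (cesaroPow α) ∧
    spectrum ℂ (cesaroPow α) = (fun z : ℂ => z ^ α) '' {z : ℂ | ∃ w : ℂ, ‖w‖ = 1 ∧ z = w + 1} ∧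
    ‖holderOp α hα‖ = ‖cesaroPow α‖ ∧
    ‖cesaroPow α‖ = (2 * α.re / ‖α‖) ^ α.re * Real.exp (α.im * Complex.arg α) ∧
    (∀ a : ℝ, α = (a : ℂ) →
      spectrum ℂ (holderOp α hα) = spectrum ℂ (cesaroPow α) ∧
      spectrum ℂ (cesaroPow α) =
        (fun t : ℝ => (⟨(2 * Real.cos t) ^ a * Real.cos (a * t),
          (2 * Real.cos t) ^ a * Real.sin (a * t)⟩ : ℂ)) '' Set.Icc (-(Real.pi / 2)) (Real.pi / 2) ∧
      ‖holderOp α hα‖ = ‖cesaroPow α‖ ∧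
      ‖cesaroPow α‖ = 2 ^ a) := by
  have e := holderOp_eq_cesaroPow hα
  refine ⟨by rw [e], ?_, by rw [e], norm_cesaroPow hα, ?_⟩
  · rw [spectrum_cesaroPow hα]
    congr 1
    ext z
    constructor
    · exact fun hz => ⟨z - 1, hz, (sub_add_cancel z 1).symm⟩
    · rintro ⟨w, hw, rfl⟩
      simpa using hw
  · rintro a rfl
    have ha : 0 < a := by simpa using hα
    refine ⟨by rw [e], spectrum_cesaroPow_ofReal ha, by rw [e], ?_⟩
    rw [norm_cesaroPow hα, Complex.norm_real, Real.norm_of_nonneg ha.le, Complex.ofReal_re,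
      Complex.ofReal_im, zero_mul, Real.exp_zero, mul_one, mul_div_assoc, div_self ha.ne', mul_one]
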